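/- **Setting.** Let $M$ be a smooth $n$-manifold, $E,F\to M$ smooth real vector bundles, and let $\mathcal M$ be the total space of $\Pi E\oplus\Pi F\to M$, with local coordinates $\phi^A=(x^i,\eta^a,c^\alpha)$ of parities $(0,1,1)$ and ghost numbers $(0,-1,1)$. Let $\mathcal N=\Pi T^*\mathcal M$, with coordinates $(\phi^A,\phi^*_A)$, where $\phi^*_A$ has parity $A+1$, ghost number $1-\mathrm{gh}(\phi^A)$ and momentum degree $\mathrm{Deg}=1$, and let $\Pi T\mathcal N$ have the further coordinates $d\phi^A,d\phi^*_A$ (parity shifted by one). An index $A$ or a function in an exponent of $-1$ stands for its parity (that of $\phi^A$, respectively of the function). With left derivatives, $C^\infty(\Pi T\mathcal N)$ carries the canonical even Poisson bracket $$\{f,g\}=\sum_A(-1)^{A(f+1)}\Big(\tfrac{\partial f}{\partial d\phi^*_A}\tfrac{\partial g}{\partial\phi^A}+(-1)^{f}\tfrac{\partial f}{\partial d\phi^A}\tfrac{\partial g}{\partial\phi^*_A}\Big)-(-1)^{Af}\Big(\tfrac{\partial f}{\partial\phi^A}\tfrac{\partial g}{\partial d\phi^*_A}-(-1)^{f}\tfrac{\partial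 f}{\partial\phi^*_A}\tfrac{\partial g}{\partial d\phi^A}\Big).$$ Put $\Delta=\sum_A(-1)^A d\phi^A d\phi^*_A$; the velocities are normalised so that $\{\Delta,z\}=(-1)^z dz$ for $z=\phi^A,\phi^*_A$. The odd bracket of functions on $\mathcal N$ is $(f,g)=\{\{\Delta,f\},g\}|_{\mathcal N}$. Let $\mathcal L=\{\phi^*=0=d\phi^*\}\subset\Pi T\mathcal N$; functions on $\mathcal L\cong\Pi T\mathcal M$ are regarded as differential forms on $\mathcal M$, with exterior differential $d\omega=\{\Delta,\omega\}|_{\mathcal L}$. Let $S\in C^\infty(\mathcal N)$ be a master function: $S$ is even, $\mathrm{gh}(S)=2$, $\mathrm{Deg}(S)>0$ (that is, $S|_{\phi^*=0}=0$) and $(S,S)=0$. Let $S^1$ be its component of momentum degree one, $Q=(S^1,-)$, $\Psi=\{\Delta,S\}$ and $\hat Q=\{\Psi,-\}|_{\mathcal L}$. A *projectible vector field* is a function $X=X^A(\phi)\phi^*_A$ on $\mathcal N$ with $QX=0$; a *weak Poisson vector field* is a function $V$ on $\mathcal N$ with $\mathrm{Deg}(V)>0$ and $(S,V)=0$; a *projectible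 form* is a function $\omega$ on $\mathcal L$ with $\hat Q\omega=0$. For a homogeneous function $X$ on $\mathcal N$ put $\imath_X\omega=(-1)^X\{X,\omega\}|_{\mathcal L}$. For an odd function $V$ on $\mathcal N$ with lift $\Gamma=\{\Delta,V\}$ put $\dot\omega=\{\Gamma,\omega\}|_{\mathcal L}$, and let $\mathcal L_V=d\circ\imath_V+\imath_V\circ d$ be the graded commutator of $d$ and $\imath_V$. **Proposition.** Let $V$ be a projectible or a weak Poisson vector field with $\epsilon(V)=1$, $\mathrm{gh}(V)=1$, let $X$ be a projectible vector field, homogeneous of some parity, and let $\omega$ be a projectible form. Then $$\dot{(\imath_X\omega)}=\imath_X(\dot\omega)+(-1)^X\{(V,X),\omega\}|_{\mathcal L},$$ and, in terms of the Lie derivative, $$\mathcal L_V\imath_X\omega=\imath_X\mathcal L_V\omega+(-1)^{X+V}\{(V,X),\omega\}|_{\mathcal L}.$$ -/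

import Mathlib

open scoped Manifold ContDiff
open Bundle

noncomputable section

namespace WeakKoszul

/-! ### Local coordinates on `Π T 𝒩`, where `𝒩 = Π T* ℳ` and `ℳ = Π E ⊕ Π F → M` -/

/-- Index set of the local coordinates `φ^A = (x^i, η^a, c^α)` of `ℳ`: `n = dim M`,
`m = rank E`, `k = rank F`. -/
abbrev Idx (n m k : ℕ) : Type := Fin n ⊕ (Fin m ⊕ Fin k)

/-- The index of `x^i`. -/
abbrev Idx.x {n m k : ℕ} (i : Fin n) : Idx n m k := Sum.inl i

/-- The index of `η^a`. -/
abbrev Idx.eta {n m k : ℕ} (a : Fin m) : Idx n m k := Sum.inr (Sum.inl a)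

/-- The index of `c^α`. -/
abbrev Idx.c {n m k : ℕ} (α : Fin k) : Idx n m k := Sum.inr (Sum.inr α)

/-- Grassmann parity of `φ^A`. -/
def Idx.parity {n m k : ℕ} : Idx n m k → ℕ
  | Sum.inl _ => 0
  | Sum.inr _ => 1

/-- Ghost number of `φ^A`. -/
def Idx.ghost {n m k : ℕ} : Idx n m k → ℤ
  | Sum.inl _ => 0
  | Sum.inr (Sum.inl _) => -1
  | Sum.inr (Sum.inr _) => 1

/-- Local coordinates of `Π T 𝒩`: a pair of flags and an index `A`. The first flag tells whether
the coordinate is a velocity, the second whether it belongs to a momentum. -/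
abbrev Coordinate (n m k : ℕ) : Type := (Bool × Bool) × Idx n m k

section Coordinates

variable {n m k : ℕ}

/-- `φ^A` -/
abbrev fld (A : Idx n m k) : Coordinate n m k := ((false, false), A)

/-- `φ*_A` -/
abbrev mom (A : Idx n m k) : Coordinate n m k := ((false, true), A)

/-- `dφ^A` -/
abbrev dfld (A : Idx n m k) : Coordinate n m k := ((true, false), A)

/-- `dφ*_A` -/
abbrev dmom (A : Idx n m k) : Coordinate n m k := ((true, true), A)

/-- Grassmann parity: `ε(φ*_A) = ε(φ^A) + 1` and `ε(dz) = ε(z) + 1`. Only its class modulo two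
matters. -/
def Coordinate.parity (z : Coordinate n m k) : ℕ :=
  z.2.parity + (if z.1.2 then 1 else 0) + (if z.1.1 then 1 else 0)

/-- Ghost number: `gh(φ*_A) = 1 - gh(φ^A)` and `gh(dz) = gh(z) - 1`. -/
def Coordinate.ghost (z : Coordinate n m k) : ℤ :=
  (if z.1.2 then 1 - z.2.ghost else z.2.ghost) - (if z.1.1 then 1 else 0)

end Coordinates

/-- The even coordinates. -/
abbrev EvenCoord (n m k : ℕ) : Type := {z : Coordinate n m k // Even z.parity}

/-- The odd coordinates. -/
abbrev OddCoord (n m k : ℕ) : Type := {z : Coordinate n m k // ¬ Even z.parity}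

/-- Values of the even coordinates. -/
abbrev Body (n m k : ℕ) : Type := EvenCoord n m k → ℝ

/-- The Grassmann algebra generated by the odd coordinates. -/
abbrev Grassmann (n m k : ℕ) : Type := ExteriorAlgebra ℝ (OddCoord n m k → ℝ)

/-- Grassmann-valued functions of the even coordinates; functions on a superdomain are those
which are smooth on its underlying open set, see `SmoothOn`. -/
abbrev SuperFun (n m k : ℕ) : Type := Body n m k → Grassmann n m k

instance (n m k : ℕ) : Module.Finite ℝ (Grassmann n m k) := by
  let _ : LinearOrder (OddCoord n m k) :=
    LinearOrder.lift' (Fintype.equivFin (OddCoord n m k)) (Equiv.injective _)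
  exact Module.Finite.of_basis (Pi.basisFun ℝ (OddCoord n m k)).ExteriorAlgebra

section Local

variable {n m k : ℕ}

/-- All real components of the Grassmann-valued function are smooth on the open set `W`. -/
def SmoothOn (W : Set (Body n m k)) (f : SuperFun n m k) : Prop :=
  ∀ l : Module.Dual ℝ (Grassmann n m k), ContDiffOn ℝ ∞ (fun p => l (f p)) W

/-- A coordinate as a superfunction. -/
def coord (z : Coordinate n m k) : SuperFun n m k := fun p =>
  if h : Even z.parity then algebraMap ℝ (Grassmann n m k) (p ⟨z, h⟩)
  else ExteriorAlgebra.ι ℝ (Pi.single (⟨z, h⟩ : OddCoord n m k) (1 : ℝ))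

/-- The left partial derivative with respect to a coordinate: the componentwise partial derivative
in the even case (it does not depend on the chosen basis), the left contraction with the dual
generator in the odd case. -/
def pd (z : Coordinate n m k) (f : SuperFun n m k) : SuperFun n m k := fun p =>
  if h : Even z.parity then
    ∑ j, (fderiv ℝ (fun q => (Module.finBasis ℝ (Grassmann n m k)).repr (f q) j) p
      (Pi.single (⟨z, h⟩ : EvenCoord n m k) (1 : ℝ))) • Module.finBasis ℝ (Grassmann n m k) j
  else CliffordAlgebra.contractLeft
    (LinearMap.proj (⟨z, h⟩ : OddCoord n m k) : (OddCoord n m k → ℝ) →ₗ[ℝ] ℝ) (f p)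

/-- `twist r F = (-1)^{r ε(F)} F`, extended linearly to inhomogeneous `F`. -/
def twist (r : ℕ) (f : SuperFun n m k) : SuperFun n m k := fun p =>
  (CliffordAlgebra.involute)^[r] (f p)

/-- The canonical even Poisson bracket on `Π T 𝒩`,
`{F,G} = ∑_A (-1)^{A(F+1)} (∂F/∂dφ*_A ∂G/∂φ^A + (-1)^F ∂F/∂dφ^A ∂G/∂φ*_A)
  - (-1)^{AF} (∂F/∂φ^A ∂G/∂dφ*_A - (-1)^F ∂F/∂φ*_A ∂G/∂dφ^A)`. -/
def bracket (f g : SuperFun n m k) : SuperFun n m k :=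
  ∑ A : Idx n m k,
    ((-1 : ℝ) ^ A.parity • (pd (dmom A) (twist A.parity f) * pd (fld A) g
        + pd (dfld A) (twist (A.parity + 1) f) * pd (mom A) g)
      - (pd (fld A) (twist A.parity f) * pd (dmom A) g
        - pd (mom A) (twist (A.parity + 1) f) * pd (dfld A) g))

/-- The canonical odd function `Δ = ∑_A (-1)^A dφ^A dφ*_A`. -/
def canonicalDelta : SuperFun n m k :=
  ∑ A : Idx n m k, (-1 : ℝ) ^ A.parity • (coord (dfld A) * coord (dmom A))

/-- Restriction to the locus where the coordinates selected by `s` vanish, regarded as a function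
of all coordinates which does not depend on the selected ones. -/
def restrict (s : Coordinate n m k → Bool) (f : SuperFun n m k) : SuperFun n m k := fun p =>
  ExteriorAlgebra.map
    (LinearMap.pi fun z : OddCoord n m k => if s z.1 then 0 else LinearMap.proj z)
    (f fun z => if s z.1 then 0 else p z)

/-- Restriction to `ℒ = {φ* = 0 = dφ*}`. -/
def restrictL (f : SuperFun n m k) : SuperFun n m k := restrict (fun z => z.1.2) f

/-- Restriction to `𝒩 = {dφ = 0 = dφ*}`. -/
def restrictN (f : SuperFun n m k) : SuperFun n m k := restrict (fun z => z.1.1) f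

/-- Restriction to the locus `{φ* = 0}`; on functions on `𝒩`, the restriction to `ℳ`. -/
def restrictM (f : SuperFun n m k) : SuperFun n m k := restrict (fun z => !z.1.1 && z.1.2) f

/-- The odd bracket generated by `Δ`: `(F,G) = {{Δ,F},G}|_𝒩`. -/
def oddBracket (f g : SuperFun n m k) : SuperFun n m k :=
  restrictN (bracket (bracket canonicalDelta f) g)

/-- The component `∑_A φ*_A (∂F/∂φ*_A)|_{φ* = 0}` of momentum degree one. -/
def linearPart (f : SuperFun n m k) : SuperFun n m k :=
  ∑ A : Idx n m k, coord (mom A) * restrictM (pd (mom A) f)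

/-- `Q F = (S¹, F)`. -/
def brst (S f : SuperFun n m k) : SuperFun n m k := oddBracket (linearPart S) f

/-- `Q̂ w = {Ψ, w}|_ℒ` with `Ψ = {Δ, S}`. -/
def liftedBrst (S w : SuperFun n m k) : SuperFun n m k :=
  restrictL (bracket (bracket canonicalDelta S) w)

/-- The interior product `ι_X w = (-1)^X {X, w}|_ℒ`. -/
def interior (X w : SuperFun n m k) : SuperFun n m k := restrictL (bracket (twist 1 X) w)

/-- The exterior differential `d w = {Δ, w}|_ℒ`. -/
def extDiff (w : SuperFun n m k) : SuperFun n m k := restrictL (bracket canonicalDelta w)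

/-- The time derivative `ẇ = {Γ, w}|_ℒ` with `Γ = {Δ, V}`. -/
def timeDeriv (V w : SuperFun n m k) : SuperFun n m k :=
  restrictL (bracket (bracket canonicalDelta V) w)

/-- The Lie derivative along `V`, as the graded commutator
`d ∘ ι_V - (-1)^V ι_V ∘ d` of the exterior differential and the interior product; here `(-1)^V`
refers to the parity of the function `V` on `𝒩`, which is opposite to that of the corresponding
vector field (so this is `d ∘ ι_V + ι_V ∘ d` for odd `V`). -/
def lieDeriv (V w : SuperFun n m k) : SuperFun n m k :=
  extDiff (interior V w) - interior (twist 1 V) (extDiff w)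

end Local

/-! ### Algebras of smooth superfunctions -/

section Algebra

variable {n m k : ℕ}

theorem smoothOn_iff (W : Set (Body n m k)) (f : SuperFun n m k) :
    SmoothOn W f ↔ ∀ j, ContDiffOn ℝ ∞
      (fun p => (Module.finBasis ℝ (Grassmann n m k)).repr (f p) j) W := by
  refine ⟨fun h j => h ((Module.finBasis ℝ (Grassmann n m k)).coord j), fun h l => ?_⟩
  have e : (fun p => l (f p)) = fun p => ∑ j,
      (Module.finBasis ℝ (Grassmann n m k)).repr (f p) j *
        l (Module.finBasis ℝ (Grassmann n m k) j) := by
    funext p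
    conv_lhs => rw [← (Module.finBasis ℝ (Grassmann n m k)).sum_repr (f p)]
    simp only [map_sum, map_smul, smul_eq_mul]
  rw [e]
  exact ContDiffOn.sum fun j _ => (h j).mul contDiffOn_const

/-- The superfunctions which are smooth on `W`, with no condition on their values off `W`. -/
def smoothSubalgebra (W : Set (Body n m k)) : Subalgebra ℝ (SuperFun n m k) where
  carrier := {f | SmoothOn W f}
  mul_mem' := by
    intro f g hf hg l
    have e : (fun p => l ((f * g) p)) = fun p => ∑ j,
        (Module.finBasis ℝ (Grassmann n m k)).repr (f p) j *
          (l ∘ₗ LinearMap.mulLeft ℝ (Module.finBasis ℝ (Grassmann n m k) j)) (g p) := by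
      funext p
      rw [Pi.mul_apply]
      conv_lhs => rw [← (Module.finBasis ℝ (Grassmann n m k)).sum_repr (f p)]
      simp only [Finset.sum_mul, map_sum, map_smul, smul_eq_mul, smul_mul_assoc,
        LinearMap.comp_apply, LinearMap.mulLeft_apply]
    rw [e]
    exact ContDiffOn.sum fun j _ => ((smoothOn_iff W f).1 hf j).mul (hg _)
  add_mem' := by
    intro f g hf hg l
    simpa using (hf l).add (hg l)
  algebraMap_mem' := by
    intro r l
    exact contDiffOn_const (c := l (algebraMap ℝ (Grassmann n m k) r))

/-- The algebra of smooth functions on the superdomain with underlying open set `W`. -/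
def smoothFunctions (W : Set (Body n m k)) : Subalgebra ℝ (W → Grassmann n m k) :=
  (smoothSubalgebra W).map
    (AlgHom.pi
      fun p : W => Pi.evalAlgHom ℝ (fun _ : Body n m k => Grassmann n m k) p.1)

/-- The smooth function on the superdomain over `W` defined by `f`. -/
def toSmooth (W : Set (Body n m k)) (f : SuperFun n m k) (hf : SmoothOn W f) :
    smoothFunctions W := ⟨fun p => f p.1, f, hf, rfl⟩

theorem smoothOn_coord (W : Set (Body n m k)) (z : Coordinate n m k) :
    SmoothOn W (coord z) := by
  intro l
  unfold coord
  split_ifs with h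
  · have e : (fun p : Body n m k => l (algebraMap ℝ (Grassmann n m k) (p ⟨z, h⟩))) =
        fun p => p ⟨z, h⟩ * l 1 := by
      funext p
      rw [Algebra.algebraMap_eq_smul_one, map_smul, smul_eq_mul]
    rw [e]
    exact ((contDiff_apply ℝ ℝ (⟨z, h⟩ : EvenCoord n m k)).contDiffOn).mul contDiffOn_const
  · exact contDiffOn_const

end Algebra

/-! ### Global functions -/

section Global

variable {n m k : ℕ} {M : Type*} [TopologicalSpace M]
  [ChartedSpace (EuclideanSpace ℝ (Fin n)) M]
  (E : M → Type*) [∀ x, TopologicalSpace (E x)] [TopologicalSpace (TotalSpace (Fin m → ℝ) E)]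
  [FiberBundle (Fin m → ℝ) E]
  (F : M → Type*) [∀ x, TopologicalSpace (F x)] [TopologicalSpace (TotalSpace (Fin k → ℝ) F)]
  [FiberBundle (Fin k → ℝ) F]

/-- A local coordinate system on `ℳ`: a smooth chart of `M` and local trivializations of `E`
and `F`. -/
structure CoordSystem where
  chart : OpenPartialHomeomorph M (EuclideanSpace ℝ (Fin n))
  chart_mem : chart ∈ IsManifold.maximalAtlas (𝓡 n) ∞ M
  trivE : Trivialization (Fin m → ℝ) (TotalSpace.proj : TotalSpace (Fin m → ℝ) E → M)
  trivE_mem : MemTrivializationAtlas trivE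
  trivF : Trivialization (Fin k → ℝ) (TotalSpace.proj : TotalSpace (Fin k → ℝ) F → M)
  trivF_mem : MemTrivializationAtlas trivF

/-- The coordinates `(x^i)` of a point of the body. -/
def xPart (p : Body n m k) : EuclideanSpace ℝ (Fin n) :=
  WithLp.toLp 2 fun i => p ⟨fld (Idx.x i), ⟨0, rfl⟩⟩

namespace CoordSystem

variable {E F}

/-- The open subset of `M` on which the coordinate system is defined. -/
def base (c : CoordSystem (n := n) (m := m) (k := k) E F) : Set M :=
  c.chart.source ∩ (c.trivE.baseSet ∩ c.trivF.baseSet)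

/-- The point of `M` with the given coordinates. -/
def point (c : CoordSystem (n := n) (m := m) (k := k) E F) (p : Body n m k) : M :=
  c.chart.symm (xPart p)

/-- The part of `Π T 𝒩` over the common domain of `c` and `c'`, in the coordinates of `c`. -/
def overlap (c c' : CoordSystem (n := n) (m := m) (k := k) E F) : Set (Body n m k) :=
  {p | xPart p ∈ c.chart.target ∧ c.point p ∈ c.base ∩ c'.base}

/-- The part of `Π T 𝒩` over the domain of `c`, in the coordinates of `c`. -/
def domain (c : CoordSystem (n := n) (m := m) (k := k) E F) : Set (Body n m k) :=
  {p | xPart p ∈ c.chart.target ∧ c.point p ∈ c.base}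

theorem overlap_subset (c c' : CoordSystem (n := n) (m := m) (k := k) E F) :
    overlap c c' ⊆ c.domain := fun _ hp => ⟨hp.1, hp.2.1⟩

/-- `ψ` expresses the coordinates of `c'` on `Π T 𝒩` through those of `c`. The coordinates `η`
and `c` change like the fibre coordinates of `E` and `F`, the momenta by
`φ*_A = ∑_B (∂φ'^B/∂φ^A) φ*'_B`, and the velocities so that `(-1)^z dz = {Δ, z}` for
`z = φ^A, φ*_A`. -/
structure IsTransition (c c' : CoordSystem (n := n) (m := m) (k := k) E F)
    (ψ : Coordinate n m k → SuperFun n m k) : Prop where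
  smooth : ∀ z, SmoothOn (overlap c c') (ψ z)
  x_eq : ∀ i, ∀ p ∈ overlap c c',
    ψ (fld (Idx.x i)) p = algebraMap ℝ (Grassmann n m k) (c'.chart (c.point p) i)
  eta_eq : ∀ a, ∀ p ∈ overlap c c',
    ψ (fld (Idx.eta a)) p =
      ∑ b, c.trivE.coordChange c'.trivE (c.point p) (Pi.single b 1) a • coord (fld (Idx.eta b)) p
  c_eq : ∀ a, ∀ p ∈ overlap c c',
    ψ (fld (Idx.c a)) p =
      ∑ b, c.trivF.coordChange c'.trivF (c.point p) (Pi.single b 1) a • coord (fld (Idx.c b)) p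
  mom_eq : ∀ A, ∀ p ∈ overlap c c',
    coord (mom A) p = ∑ B, pd (fld A) (ψ (fld B)) p * ψ (mom B) p
  dfld_eq : ∀ A, ∀ p ∈ overlap c c',
    (-1 : ℝ) ^ (fld A).parity • ψ (dfld A) p = bracket canonicalDelta (ψ (fld A)) p
  dmom_eq : ∀ A, ∀ p ∈ overlap c c',
    (-1 : ℝ) ^ (mom A).parity • ψ (dmom A) p = bracket canonicalDelta (ψ (mom A)) p

/-- The algebra homomorphism `Φ` is the change of coordinates on `Π T 𝒩` from `c'` to `c`; as
a homomorphism between algebras of smooth functions on superdomains it is determined by the images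
of the coordinates. -/
def IsCoordinateChange (c c' : CoordSystem (n := n) (m := m) (k := k) E F)
    (Φ : smoothFunctions (overlap c' c) →ₐ[ℝ] smoothFunctions (overlap c c')) : Prop :=
  ∃ (ψ : Coordinate n m k → SuperFun n m k) (hψ : IsTransition c c' ψ),
    ∀ z : Coordinate n m k,
      Φ (toSmooth _ (coord z) (smoothOn_coord _ z)) = toSmooth _ (ψ z) (hψ.smooth z)

end CoordSystem

/-- Families of local expressions, one for each coordinate system. -/
abbrev LocalFamily : Type _ :=
  CoordSystem (n := n) (m := m) (k := k) E F → SuperFun n m k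

variable {E F}

/-- The family consists of the local expressions of a smooth function on `Π T 𝒩`: each of them is
smooth on the coordinate domain, and they correspond to each other under changes of
coordinates. -/
structure IsGlobal (f : LocalFamily (n := n) (m := m) (k := k) E F) : Prop where
  smooth : ∀ c, SmoothOn c.domain (f c)
  compatible : ∀ c c',
    ∃ Φ : smoothFunctions (CoordSystem.overlap c' c) →ₐ[ℝ]
        smoothFunctions (CoordSystem.overlap c c'),
      CoordSystem.IsCoordinateChange c c' Φ ∧
      Φ (toSmooth _ (f c') fun l => (smooth c' l).mono (CoordSystem.overlap_subset c' c)) =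
        toSmooth _ (f c) fun l => (smooth c l).mono (CoordSystem.overlap_subset c c')

/-- `f` is homogeneous of Grassmann parity `r` (modulo two). -/
def HasParity (r : ℕ) (f : LocalFamily (n := n) (m := m) (k := k) E F) : Prop :=
  ∀ c, Set.EqOn (twist 1 (f c)) ((-1 : ℝ) ^ r • f c) c.domain

/-- `f` is homogeneous of ghost number `g`: an eigenfunction of the Euler vector field. -/
def HasGhost (g : ℤ) (f : LocalFamily (n := n) (m := m) (k := k) E F) : Prop :=
  ∀ c, Set.EqOn (∑ z : Coordinate n m k, (z.ghost : ℝ) • (coord z * pd z (f c)))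
    ((g : ℝ) • f c) c.domain

/-- A smooth function on `𝒩`, regarded as a function on `Π T 𝒩`. -/
def IsFunctionOnN (f : LocalFamily (n := n) (m := m) (k := k) E F) : Prop :=
  IsGlobal f ∧ ∀ c, Set.EqOn (restrictN (f c)) (f c) c.domain

/-- A smooth function on `ℒ`, that is, a differential form on `ℳ`. -/
def IsFunctionOnL (f : LocalFamily (n := n) (m := m) (k := k) E F) : Prop :=
  IsGlobal f ∧ ∀ c, Set.EqOn (restrictL (f c)) (f c) c.domain

/-- `Deg f > 0`: no component of momentum degree zero. -/
def HasPositiveDeg (f : LocalFamily (n := n) (m := m) (k := k) E F) : Prop :=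
  ∀ c, Set.EqOn (restrictM (f c)) 0 c.domain

/-- `Deg f = 1`, that is, `f = X^A(φ) φ*_A` for a function `f` on `𝒩`. -/
def HasDegOne (f : LocalFamily (n := n) (m := m) (k := k) E F) : Prop :=
  ∀ c, Set.EqOn (∑ A : Idx n m k, coord (mom A) * pd (mom A) (f c)) (f c) c.domain

/-- A master function: `ε(S) = 0`, `gh(S) = 2`, `Deg(S) > 0` and `(S,S) = 0`. Its terms which
contain neither `η` nor `c*` are `T^a η*_a + c^α R^i_α x*_i + P^{ij} x*_j x*_i`, with the constraints
`T`, the gauge generators `R` and the bivector `P`. No rank condition is imposed on them. -/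
structure IsMasterFunction (S : LocalFamily (n := n) (m := m) (k := k) E F) : Prop where
  onN : IsFunctionOnN S
  parity : HasParity 0 S
  ghost : HasGhost 2 S
  deg : HasPositiveDeg S
  master : ∀ c, Set.EqOn (oddBracket (S c) (S c)) 0 c.domain

/-- A projectible vector field, as a vector field `X^A(φ) φ*_A` on `ℳ` which is a
`Q`-cocycle. -/
structure IsProjectibleVectorField (S X : LocalFamily (n := n) (m := m) (k := k) E F) :
    Prop where
  onN : IsFunctionOnN X
  deg : HasDegOne X
  cocycle : ∀ c, Set.EqOn (brst (S c) (X c)) 0 c.domain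

/-- A weak Poisson vector field, as a function on `𝒩` of positive momentum degree with
`(S,V) = 0`. -/
structure IsWeakPoissonVectorField (S V : LocalFamily (n := n) (m := m) (k := k) E F) :
    Prop where
  onN : IsFunctionOnN V
  deg : HasPositiveDeg V
  master : ∀ c, Set.EqOn (oddBracket (S c) (V c)) 0 c.domain

/-- A projectible differential form: a function on `ℒ` which is a `Q̂`-cocycle. -/
structure IsProjectibleForm (S w : LocalFamily (n := n) (m := m) (k := k) E F) : Prop where
  onL : IsFunctionOnL w
  cocycle : ∀ c, Set.EqOn (liftedBrst (S c) (w c)) 0 c.domain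

end Global

end WeakKoszul

end

/-!
Write `Γ = {Δ, V}`. Since `Δ`, `V` and `X` vanish on the Lagrangian submanifold `ℒ`, so does `Γ`,
and the bracket of such a function with `ω`, restricted to `ℒ`, depends only on `ω|_ℒ`. Hence the
inner restrictions in `{Γ, {X, ω}|_ℒ}|_ℒ` and `{X, {Γ, ω}|_ℒ}|_ℒ` may be dropped, and the first
identity becomes the graded Jacobi identity for `Γ`, `X` and `ω`; the remaining term involves
`{Γ, X}`, which is `(V, X)` because the second derivatives of `Δ` are constant, so that `{Γ, X}`
already is a function on `𝒩`. The Jacobi identity for `Δ`, `V` and `ω` shows in the same way that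
`𝓛_V = (-1)^V d/dt`, and the second identity follows from the first.
-/

noncomputable section

namespace WeakKoszul

/-- A supercommutative algebra with graded commuting left derivations `D z`, paired into conjugate
variables, and the constant coefficients of an even Poisson bracket: an algebraic model of the
functions of Darboux coordinates `z`. Parities are natural numbers, and only their classes modulo
two matter; `invol` multiplies a function of parity `a` by `(-1) ^ a`. -/
structure DarbouxSuperalgebra (𝕜 Z R : Type*) [CommRing 𝕜] [Ring R] [Algebra 𝕜 R] where
  parity : Z → ℕ
  invol : R →ₐ[𝕜] R
  D : Z → R →ₗ[𝕜] R
  conj : Z → Z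
  sign : Z → 𝕜
  D_mul : ∀ z f g, D z (f * g) = D z f * g + (invol ^ parity z) f * D z g
  invol_D : ∀ z f, invol (D z f) = (-1 : 𝕜) ^ parity z • D z (invol f)
  D_comm : ∀ z w f, D z (D w f) = (-1 : 𝕜) ^ (parity z * parity w) • D w (D z f)
  supercomm : ∀ (a b : ℕ) (f g : R), invol f = (-1 : 𝕜) ^ a • f → invol g = (-1 : 𝕜) ^ b • g →
    f * g = (-1 : 𝕜) ^ (a * b) • (g * f)
  conj_involutive : Function.Involutive conj
  even_parity_conj : ∀ z, Even (parity (conj z)) ↔ Even (parity z)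
  sign_conj : ∀ z, sign (conj z) = -((-1) ^ parity z * sign z)

theorem algHom_pow_apply_eq_pow_smul {𝕜 R : Type*} [CommSemiring 𝕜] [Semiring R] [Algebra 𝕜 R]
    {φ : R →ₐ[𝕜] R} {t : 𝕜} {x : R} (h : φ x = t • x) (r : ℕ) : (φ ^ r) x = t ^ r • x := by
  induction r with
  | zero => simp only [pow_zero, AlgHom.one_apply, one_smul]
  | succ r ih => rw [pow_succ', AlgHom.mul_apply, ih, map_smul, h, smul_smul, pow_succ]

theorem neg_one_pow_smul_congr {𝕜 R : Type*} [Ring 𝕜] [AddCommGroup R] [Module 𝕜 R] {i j : ℕ}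
    (h : Even i ↔ Even j) (x : R) : (-1 : 𝕜) ^ i • x = (-1 : 𝕜) ^ j • x := by
  rw [neg_one_pow_congr h]

namespace DarbouxSuperalgebra

variable {𝕜 Z R : Type*} [CommRing 𝕜] [Ring R] [Algebra 𝕜 R] (A : DarbouxSuperalgebra 𝕜 Z R)

/-- The functions of parity `a`. -/
def homogeneous (a : ℕ) : Submodule 𝕜 R :=
  Module.End.eigenspace A.invol.toLinearMap ((-1) ^ a)

variable {A} {a b : ℕ} {f g : R}

theorem mem_homogeneous : f ∈ A.homogeneous a ↔ A.invol f = (-1 : 𝕜) ^ a • f :=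
  Module.End.mem_eigenspace_iff

theorem homogeneous_congr (h : Even a ↔ Even b) : A.homogeneous a = A.homogeneous b := by
  rw [homogeneous, homogeneous, neg_one_pow_congr h]

theorem invol_pow_apply (hf : f ∈ A.homogeneous a) (r : ℕ) :
    (A.invol ^ r) f = (-1 : 𝕜) ^ (a * r) • f := by
  rw [algHom_pow_apply_eq_pow_smul (mem_homogeneous.1 hf), pow_mul]

theorem D_mem_homogeneous (hf : f ∈ A.homogeneous a) (z : Z) :
    A.D z f ∈ A.homogeneous (a + A.parity z) := by
  rw [mem_homogeneous] at *
  rw [A.invol_D, hf, map_smul, smul_smul, ← pow_add, add_comm]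

theorem mul_mem_homogeneous (hf : f ∈ A.homogeneous a) (hg : g ∈ A.homogeneous b) :
    f * g ∈ A.homogeneous (a + b) := by
  rw [mem_homogeneous] at *
  rw [map_mul, hf, hg, smul_mul_smul_comm, ← pow_add]

theorem mul_comm_of_homogeneous (hf : f ∈ A.homogeneous a) (hg : g ∈ A.homogeneous b) :
    f * g = (-1 : 𝕜) ^ (a * b) • (g * f) :=
  A.supercomm a b f g (mem_homogeneous.1 hf) (mem_homogeneous.1 hg)

theorem D_mul_of_homogeneous (hf : f ∈ A.homogeneous a) (z : Z) (g : R) :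
    A.D z (f * g) = A.D z f * g + (-1 : 𝕜) ^ (a * A.parity z) • (f * A.D z g) := by
  rw [A.D_mul, invol_pow_apply hf, smul_mul_assoc]

theorem D_eq_zero_of_mem_bot (hf : f ∈ (⊥ : Subalgebra 𝕜 R)) (z : Z) : A.D z f = 0 := by
  obtain ⟨t, rfl⟩ := Algebra.mem_bot.1 hf
  have h : A.D z 1 = 0 := by simpa using A.D_mul z 1 1
  rw [Algebra.algebraMap_eq_smul_one, map_smul, h, smul_zero]

theorem D_D_mul_mem_bot (hf : f ∈ A.homogeneous a) (hDf : ∀ z, A.D z f ∈ (⊥ : Subalgebra 𝕜 R))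
    (hDg : ∀ z, A.D z g ∈ (⊥ : Subalgebra 𝕜 R)) (z w : Z) :
    A.D z (A.D w (f * g)) ∈ (⊥ : Subalgebra 𝕜 R) := by
  rw [D_mul_of_homogeneous hf, map_add, map_smul, D_mul_of_homogeneous (D_mem_homogeneous hf w),
    D_mul_of_homogeneous hf, D_eq_zero_of_mem_bot (hDf w), D_eq_zero_of_mem_bot (hDg w), zero_mul,
    zero_add, mul_zero, smul_zero, add_zero]
  exact add_mem (Subalgebra.smul_mem _ (mul_mem (hDf w) (hDg z)) _)
    (Subalgebra.smul_mem _ (mul_mem (hDf z) (hDg w)) _)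

variable [Fintype Z]

variable (A) in
/-- The even Poisson bracket, `∑ z, ± ∂f/∂z ∂g/∂z'` with `z'` conjugate to `z`. -/
def pb : R →ₗ[𝕜] R →ₗ[𝕜] R :=
  ∑ z, A.sign z • (LinearMap.mul 𝕜 R).compl₁₂
    (A.D z ∘ₗ (A.invol ^ A.parity z).toLinearMap) (A.D (A.conj z))

theorem pb_apply (f g : R) :
    A.pb f g = ∑ z, A.sign z • (A.D z ((A.invol ^ A.parity z) f) * A.D (A.conj z) g) := by
  simp only [pb, LinearMap.sum_apply, LinearMap.smul_apply, LinearMap.compl₁₂_apply,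
    LinearMap.comp_apply, AlgHom.toLinearMap_apply, LinearMap.mul_apply']

theorem pb_eq_sum (hf : f ∈ A.homogeneous a) (g : R) :
    A.pb f g = ∑ z, A.sign z • (-1 : 𝕜) ^ (a * A.parity z) • (A.D z f * A.D (A.conj z) g) := by
  simp only [pb_apply, invol_pow_apply hf, map_smul, smul_mul_assoc]

theorem pb_mem_homogeneous (hf : f ∈ A.homogeneous a) (hg : g ∈ A.homogeneous b) :
    A.pb f g ∈ A.homogeneous (a + b) := by
  rw [pb_eq_sum hf]
  refine sum_mem fun z _ => Submodule.smul_mem _ _ (Submodule.smul_mem _ _ ?_)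
  have h := mul_mem_homogeneous (D_mem_homogeneous hf z) (D_mem_homogeneous hg (A.conj z))
  rwa [homogeneous_congr (b := a + b) (by
    simp only [Nat.even_add, A.even_parity_conj]; tauto)] at h

theorem pb_antisymm (hf : f ∈ A.homogeneous a) (hg : g ∈ A.homogeneous b) :
    A.pb f g = -((-1 : 𝕜) ^ (a * b) • A.pb g f) := by
  rw [pb_eq_sum hf, pb_eq_sum hg, Finset.smul_sum, ← Finset.sum_neg_distrib]
  refine Fintype.sum_equiv A.conj_involutive.toPerm _ _ fun z => ?_
  rw [Function.Involutive.coe_toPerm, A.conj_involutive z, A.sign_conj,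
    mul_comm_of_homogeneous (D_mem_homogeneous hf z) (D_mem_homogeneous hg _), neg_smul, smul_neg,
    neg_neg, mul_comm _ (A.sign z), mul_smul, smul_comm _ (A.sign z)]
  simp only [smul_smul, ← pow_add]
  rw [mul_smul, mul_smul]
  congr 1
  apply neg_one_pow_smul_congr
  simp only [Nat.even_add, Nat.even_mul, A.even_parity_conj]
  tauto

theorem D_pb (hf : f ∈ A.homogeneous a) (w : Z) (g : R) :
    A.D w (A.pb f g) =
      A.pb (A.D w f) g + (-1 : 𝕜) ^ (a * A.parity w) • A.pb f (A.D w g) := by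
  rw [pb_eq_sum hf, pb_eq_sum (D_mem_homogeneous hf w), pb_eq_sum hf, map_sum, Finset.smul_sum,
    ← Finset.sum_add_distrib]
  refine Finset.sum_congr rfl fun z _ => ?_
  rw [map_smul, map_smul, D_mul_of_homogeneous (D_mem_homogeneous hf z), A.D_comm w z f,
    A.D_comm w (A.conj z) g, smul_comm _ (A.sign z), ← smul_add, smul_add, smul_mul_assoc,
    mul_smul_comm]
  simp only [smul_smul, ← pow_add]
  congr 2 <;> apply neg_one_pow_smul_congr <;>
    simp only [Nat.even_add, Nat.even_mul, A.even_parity_conj] <;> tauto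

theorem pb_mul_right (hf : f ∈ A.homogeneous a) (hg : g ∈ A.homogeneous b) (h : R) :
    A.pb f (g * h) = A.pb f g * h + (-1 : 𝕜) ^ (a * b) • (g * A.pb f h) := by
  simp only [pb_eq_sum hf, Finset.sum_mul, Finset.mul_sum, Finset.smul_sum]
  rw [← Finset.sum_add_distrib]
  refine Finset.sum_congr rfl fun z _ => ?_
  rw [D_mul_of_homogeneous hg, mul_add, mul_smul_comm, ← mul_assoc, ← mul_assoc,
    mul_comm_of_homogeneous (D_mem_homogeneous hf z) hg]
  simp only [smul_mul_assoc, mul_smul_comm, mul_assoc, smul_comm ((-1 : 𝕜) ^ _) (A.sign z),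
    ← smul_add]
  simp only [smul_add, smul_smul ((-1 : 𝕜) ^ _), ← pow_add]
  congr 2
  apply neg_one_pow_smul_congr
  simp only [Nat.even_add, Nat.even_mul, A.even_parity_conj]
  tauto

/-- The terms of `{f, {g, h}}` with second derivatives of `h` are graded symmetric in `f`
and `g`. -/
theorem sum_D_mul_pb_D_comm (hf : f ∈ A.homogeneous a) (hg : g ∈ A.homogeneous b) (h : R) :
    ∑ w, A.sign w • (-1 : 𝕜) ^ ((a + b) * A.parity w) • (A.D w g * A.pb f (A.D (A.conj w) h)) =
      (-1 : 𝕜) ^ (a * b) • ∑ w, A.sign w • (-1 : 𝕜) ^ ((a + b) * A.parity w) •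
        (A.D w f * A.pb g (A.D (A.conj w) h)) := by
  simp only [pb_eq_sum hf, pb_eq_sum hg, Finset.mul_sum, Finset.smul_sum]
  rw [Finset.sum_comm]
  refine Finset.sum_congr rfl fun z _ => Finset.sum_congr rfl fun w _ => ?_
  rw [A.D_comm (A.conj z)]
  simp only [mul_smul_comm, ← mul_assoc]
  rw [mul_comm_of_homogeneous (D_mem_homogeneous hg w) (D_mem_homogeneous hf z), smul_mul_assoc]
  simp only [smul_comm ((-1 : 𝕜) ^ _) (A.sign _)]
  rw [smul_comm (A.sign w) (A.sign z)]
  simp only [smul_smul ((-1 : 𝕜) ^ _), ← pow_add]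
  congr 2
  apply neg_one_pow_smul_congr
  simp only [Nat.even_add, Nat.even_mul, A.even_parity_conj]
  grind

theorem pb_pb_eq_sum (hf : f ∈ A.homogeneous a) (hg : g ∈ A.homogeneous b) (h : R) :
    A.pb f (A.pb g h) =
      ∑ w, A.sign w • (-1 : 𝕜) ^ (b * A.parity w) • (A.pb f (A.D w g) * A.D (A.conj w) h) +
      (-1 : 𝕜) ^ (a * b) • ∑ w, A.sign w • (-1 : 𝕜) ^ ((a + b) * A.parity w) •
        (A.D w g * A.pb f (A.D (A.conj w) h)) := by
  rw [pb_eq_sum hg, map_sum, Finset.smul_sum, ← Finset.sum_add_distrib]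
  refine Finset.sum_congr rfl fun w _ => ?_
  rw [map_smul, map_smul, pb_mul_right hf (D_mem_homogeneous hg w), smul_comm _ (A.sign w),
    ← smul_add, smul_add, smul_smul, smul_smul, ← pow_add, ← pow_add]
  ring_nf

theorem pb_D_right (hf : f ∈ A.homogeneous a) (hg : g ∈ A.homogeneous b) (w : Z) :
    A.pb f (A.D w g) = (-1 : 𝕜) ^ (a * A.parity w) • A.D w (A.pb f g) +
      (-1 : 𝕜) ^ (a * A.parity w + (a + A.parity w) * b) • A.pb g (A.D w f) := by
  rw [D_pb hf, pb_antisymm (D_mem_homogeneous hf w) hg, smul_add, smul_neg, smul_smul, smul_smul,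
    ← pow_add, ← pow_add, (Even.add_self _).neg_one_pow, one_smul]
  abel

theorem pb_jacobi (hf : f ∈ A.homogeneous a) (hg : g ∈ A.homogeneous b) (h : R) :
    A.pb f (A.pb g h) = A.pb (A.pb f g) h + (-1 : 𝕜) ^ (a * b) • A.pb g (A.pb f h) := by
  rw [pb_pb_eq_sum hf hg, pb_pb_eq_sum hg hf, sum_D_mul_pb_D_comm hf hg,
    pb_eq_sum (pb_mem_homogeneous hf hg), smul_add, ← add_assoc, add_comm b a, mul_comm b a]
  congr 1
  rw [Finset.smul_sum, ← Finset.sum_add_distrib]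
  refine Finset.sum_congr rfl fun w _ => ?_
  rw [pb_D_right hf hg, add_mul, smul_mul_assoc, smul_mul_assoc, smul_comm _ (A.sign w),
    ← smul_add, smul_add]
  simp only [smul_smul ((-1 : 𝕜) ^ _), ← pow_add]
  congr 2 <;> apply neg_one_pow_smul_congr <;> simp only [Nat.even_add, Nat.even_mul] <;> tauto

end DarbouxSuperalgebra

section LagrangianRestriction

variable {𝕜 Z R : Type*} [CommRing 𝕜] [Ring R] [Algebra 𝕜 R]

/-- The restriction `ρ` to a Lagrangian subspace, regarded as an idempotent endomorphism: it sets to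
zero the coordinates selected by `s`, exactly one from each conjugate pair. -/
structure IsLagrangianRestriction (A : DarbouxSuperalgebra 𝕜 Z R) (s : Z → Bool)
    (ρ : R →ₐ[𝕜] R) : Prop where
  conj : ∀ z, s (A.conj z) = !s z
  idem : ∀ f, ρ (ρ f) = ρ f
  commute_invol : Commute ρ A.invol
  D_tangent : ∀ z, s z = false → ∀ f, A.D z (ρ f) = ρ (A.D z f)
  D_normal : ∀ z, s z = true → ∀ f, A.D z (ρ f) = 0

namespace IsLagrangianRestriction

variable {A : DarbouxSuperalgebra 𝕜 Z R} {s : Z → Bool} {ρ : R →ₐ[𝕜] R} {a : ℕ} {f g : R}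

theorem apply_invol_pow (hρ : IsLagrangianRestriction A s ρ) (r : ℕ) (f : R) :
    ρ ((A.invol ^ r) f) = (A.invol ^ r) (ρ f) :=
  DFunLike.congr_fun (hρ.commute_invol.pow_right r) f

theorem D_eq_zero_of_fixed (hρ : IsLagrangianRestriction A s ρ) (hf : ρ f = f) {z : Z}
    (hz : s z = true) : A.D z f = 0 := by
  rw [← hf, hρ.D_normal z hz]

variable [Fintype Z]

theorem pb_restrict (hρ : IsLagrangianRestriction A s ρ) (hf : ρ f = 0) (g : R) :
    ρ (A.pb f (ρ g)) = ρ (A.pb f g) := by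
  simp only [DarbouxSuperalgebra.pb_apply, map_sum, map_smul, map_mul]
  refine Finset.sum_congr rfl fun z _ => ?_
  cases hz : s z with
  | false => simp only [← hρ.D_tangent z hz, hρ.apply_invol_pow, hf, map_zero, zero_mul]
  | true => rw [hρ.D_tangent (A.conj z) (by rw [hρ.conj, hz, Bool.not_true]), hρ.idem]

theorem pb_eq_zero (hρ : IsLagrangianRestriction A s ρ) (hf : ρ f = 0) (hg : ρ g = 0) :
    ρ (A.pb f g) = 0 := by
  rw [← hρ.pb_restrict hf, hg, map_zero, map_zero]

theorem pb_fixed (hρ : IsLagrangianRestriction A s ρ) (hf : f ∈ A.homogeneous a)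
    (hDf : ∀ z, s z = true → ρ (A.D z f) = A.D z f) (hg : ρ g = g) :
    ρ (A.pb f g) = A.pb f g := by
  simp only [DarbouxSuperalgebra.pb_eq_sum hf, map_sum, map_smul, map_mul]
  refine Finset.sum_congr rfl fun z _ => ?_
  have hs := hρ.conj z
  cases hz : s z with
  | false =>
    rw [hz, Bool.not_false] at hs
    rw [hρ.D_eq_zero_of_fixed hg hs, map_zero, mul_zero, mul_zero]
  | true =>
    rw [hz, Bool.not_true] at hs
    rw [hDf z hz, ← hρ.D_tangent (A.conj z) hs, hg]

/-- By the Leibniz rule, only second derivatives of `Δ` enter the derivatives of `{Δ, f}` along the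
coordinates on which `f` does not depend. -/
theorem derived_pb_fixed (hρ : IsLagrangianRestriction A s ρ) {b : ℕ} {Δ : R}
    (hΔ : Δ ∈ A.homogeneous a) (hD : ∀ z w, A.D z (A.D w Δ) ∈ (⊥ : Subalgebra 𝕜 R))
    (hf : f ∈ A.homogeneous b) (hfρ : ρ f = f) (hgρ : ρ g = g) :
    ρ (A.pb (A.pb Δ f) g) = A.pb (A.pb Δ f) g := by
  refine hρ.pb_fixed (DarbouxSuperalgebra.pb_mem_homogeneous hΔ hf) (fun w hw => ?_) hgρ
  rw [DarbouxSuperalgebra.D_pb hΔ, hρ.D_eq_zero_of_fixed hfρ hw, map_zero, smul_zero, add_zero]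
  refine hρ.pb_fixed (DarbouxSuperalgebra.D_mem_homogeneous hΔ w) (fun z _ => ?_) hfρ
  obtain ⟨t, ht⟩ := Algebra.mem_bot.1 (hD z w)
  rw [← ht, AlgHom.commutes]

end IsLagrangianRestriction

end LagrangianRestriction

/-- An algebraic model of the functions on `Π T 𝒩`: Darboux coordinates, the function `Δ`, and the
restrictions to the Lagrangian submanifolds `ℒ` and `𝒩`. -/
structure PhaseSpace (𝕜 Z R : Type*) [CommRing 𝕜] [Ring R] [Algebra 𝕜 R] extends
    DarbouxSuperalgebra 𝕜 Z R where
  isNormalL : Z → Bool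
  resL : R →ₐ[𝕜] R
  isLagrangianL : IsLagrangianRestriction toDarbouxSuperalgebra isNormalL resL
  isNormalN : Z → Bool
  resN : R →ₐ[𝕜] R
  isLagrangianN : IsLagrangianRestriction toDarbouxSuperalgebra isNormalN resN
  delta : R
  delta_mem : delta ∈ toDarbouxSuperalgebra.homogeneous 1
  resL_delta : resL delta = 0
  D_D_delta : ∀ z w, D z (D w delta) ∈ (⊥ : Subalgebra 𝕜 R)

namespace PhaseSpace

variable {𝕜 Z R : Type*} [CommRing 𝕜] [Ring R] [Algebra 𝕜 R]
  (P : PhaseSpace 𝕜 Z R) {V X : R} {a b : ℕ}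

theorem resL_invol (hX : P.resL X = 0) : P.resL (P.invol X) = 0 := by
  simpa only [pow_one, hX, map_zero] using P.isLagrangianL.apply_invol_pow 1 X

/-- A function on `𝒩` of parity `a` which vanishes on `ℒ`: a multivector field on `ℳ` without
component of degree zero. -/
structure IsMultivector (a : ℕ) (V : R) : Prop where
  mem : V ∈ P.homogeneous a
  resL_eq : P.resL V = 0
  resN_eq : P.resN V = V

variable [Fintype Z]

/-- The derived odd bracket `(F,G) = {{Δ,F},G}|_𝒩`; compare `WeakKoszul.oddBracket`. -/
def oddBracket (V X : R) : R := P.resN (P.pb (P.pb P.delta V) X)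

/-- The interior product `ι_X w = (-1)^X {X, w}|_ℒ`; compare `WeakKoszul.interior`. -/
def interior (X : R) : R →ₗ[𝕜] R := P.resL.toLinearMap ∘ₗ P.pb (P.invol X)

/-- The exterior differential `d w = {Δ, w}|_ℒ`; compare `WeakKoszul.extDiff`. -/
def extDiff : R →ₗ[𝕜] R := P.resL.toLinearMap ∘ₗ P.pb P.delta

/-- The evolution `ẇ = {{Δ, V}, w}|_ℒ` along `V`; compare `WeakKoszul.timeDeriv`. -/
def timeDeriv (V : R) : R →ₗ[𝕜] R := P.resL.toLinearMap ∘ₗ P.pb (P.pb P.delta V)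

/-- The graded commutator of `d` and `ι_V`; compare `WeakKoszul.lieDeriv`. -/
def lieDeriv (V w : R) : R :=
  P.extDiff (P.interior V w) - P.interior (P.invol V) (P.extDiff w)

theorem resL_pb_delta (hV : P.resL V = 0) : P.resL (P.pb P.delta V) = 0 :=
  P.isLagrangianL.pb_eq_zero P.resL_delta hV

variable {P}

theorem oddBracket_eq_pb (hV : V ∈ P.homogeneous a) (hVN : P.resN V = V) (hXN : P.resN X = X) :
    P.oddBracket V X = P.pb (P.pb P.delta V) X :=
  P.isLagrangianN.derived_pb_fixed P.delta_mem P.D_D_delta hV hVN hXN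

theorem timeDeriv_interior (hV : P.IsMultivector a V) (hX : P.IsMultivector b X) (w : R) :
    P.timeDeriv V (P.interior X w) =
      (-1 : 𝕜) ^ ((a + 1) * b) • P.interior X (P.timeDeriv V w) +
        (-1 : 𝕜) ^ b • P.resL (P.pb (P.oddBracket V X) w) := by
  have hΓ := DarbouxSuperalgebra.pb_mem_homogeneous P.delta_mem hV.mem
  simp only [timeDeriv, interior, LinearMap.comp_apply, AlgHom.toLinearMap_apply]
  rw [P.isLagrangianL.pb_restrict (P.resL_pb_delta hV.resL_eq),
    P.isLagrangianL.pb_restrict (P.resL_invol hX.resL_eq),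
    oddBracket_eq_pb hV.mem hV.resN_eq hX.resN_eq, DarbouxSuperalgebra.mem_homogeneous.1 hX.mem]
  simp only [map_smul, LinearMap.smul_apply, DarbouxSuperalgebra.pb_jacobi hΓ hX.mem, map_add,
    smul_add, add_comm 1 a, smul_comm ((-1 : 𝕜) ^ b)]
  rw [add_comm]

theorem lieDeriv_eq_timeDeriv (hV : V ∈ P.homogeneous a) (hVL : P.resL V = 0) (w : R) :
    P.lieDeriv V w = (-1 : 𝕜) ^ a • P.timeDeriv V w := by
  simp only [lieDeriv, timeDeriv, interior, extDiff, LinearMap.comp_apply,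
    AlgHom.toLinearMap_apply]
  rw [P.isLagrangianL.pb_restrict P.resL_delta,
    P.isLagrangianL.pb_restrict (P.resL_invol (P.resL_invol hVL)),
    DarbouxSuperalgebra.mem_homogeneous.1 hV]
  simp only [map_smul, LinearMap.smul_apply, DarbouxSuperalgebra.mem_homogeneous.1 hV,
    DarbouxSuperalgebra.pb_jacobi P.delta_mem hV, map_add, smul_add, one_mul, add_sub_cancel_right]

theorem lieDeriv_interior (hV : P.IsMultivector a V) (hX : P.IsMultivector b X) (w : R) :
    P.lieDeriv V (P.interior X w) =
      (-1 : 𝕜) ^ ((a + 1) * b) • P.interior X (P.lieDeriv V w) +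
        (-1 : 𝕜) ^ (b + a) • P.resL (P.pb (P.oddBracket V X) w) := by
  rw [lieDeriv_eq_timeDeriv hV.mem hV.resL_eq, lieDeriv_eq_timeDeriv hV.mem hV.resL_eq,
    timeDeriv_interior hV hX, smul_add, map_smul, smul_comm, smul_smul, ← pow_add,
    smul_smul, ← pow_add, add_comm b a]

end PhaseSpace

section Exterior

open CliffordAlgebra

variable {R M N : Type*} [CommRing R] [AddCommGroup M] [Module R M] [AddCommGroup N] [Module R N]

theorem contractLeft_mul {Q : QuadraticForm R M} (d : Module.Dual R M) (x y : CliffordAlgebra Q) :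
    contractLeft d (x * y) = contractLeft d x * y + involute x * contractLeft d y := by
  induction x using CliffordAlgebra.left_induction with
  | algebraMap r =>
    rw [contractLeft_algebraMap_mul, contractLeft_algebraMap, zero_mul, zero_add, AlgHom.commutes]
  | add x x' hx hx' =>
    simp only [add_mul, map_add, hx, hx']
    abel
  | ι_mul x v hx =>
    rw [mul_assoc, contractLeft_ι_mul, hx, contractLeft_ι_mul, map_mul, involute_ι]
    simp only [mul_add, sub_mul, smul_mul_assoc, neg_mul, mul_assoc]
    abel

theorem involute_contractLeft {Q : QuadraticForm R M} (d : Module.Dual R M)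
    (x : CliffordAlgebra Q) : involute (contractLeft d x) = -contractLeft d (involute x) := by
  induction x using CliffordAlgebra.left_induction with
  | algebraMap r => simp only [AlgHom.commutes, contractLeft_algebraMap, map_zero, neg_zero]
  | add x x' hx hx' => simp only [map_add, hx, hx', neg_add]
  | ι_mul x v hx =>
    simp only [contractLeft_ι_mul, map_sub, map_smul, map_mul, involute_ι, hx, neg_mul, map_neg,
      mul_neg]
    abel

theorem contractLeft_map (t : M →ₗ[R] N) (d : Module.Dual R N) (x : ExteriorAlgebra R M) :
    contractLeft d (ExteriorAlgebra.map t x) =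
      ExteriorAlgebra.map t (contractLeft (d ∘ₗ t) x) := by
  induction x using CliffordAlgebra.left_induction with
  | algebraMap r => simp only [AlgHom.commutes, contractLeft_algebraMap, map_zero]
  | add x x' hx hx' => simp only [map_add, hx, hx']
  | ι_mul x v hx =>
    have h : ExteriorAlgebra.map t (ι 0 v) = ι 0 (t v) := ExteriorAlgebra.map_apply_ι t v
    simp only [map_mul, h, contractLeft_ι_mul, map_sub, map_smul, hx, LinearMap.comp_apply]

theorem map_involute (t : M →ₗ[R] N) (x : ExteriorAlgebra R M) :
    ExteriorAlgebra.map t (involute x) = involute (ExteriorAlgebra.map t x) := by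
  induction x using CliffordAlgebra.left_induction with
  | algebraMap r => simp only [AlgHom.commutes]
  | add x x' hx hx' => simp only [map_add, hx, hx']
  | ι_mul x v hx =>
    have h : ExteriorAlgebra.map t (ι 0 v) = ι 0 (t v) := ExteriorAlgebra.map_apply_ι t v
    simp only [map_mul, h, involute_ι, map_neg, hx]

theorem ι_mul_eq_involute_mul (v : M) (x : ExteriorAlgebra R M) :
    ExteriorAlgebra.ι R v * x = involute x * ExteriorAlgebra.ι R v := by
  induction x using CliffordAlgebra.left_induction with
  | algebraMap r => rw [AlgHom.commutes]; exact (Algebra.commutes r _).symm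
  | add x x' hx hx' => simp only [map_add, mul_add, add_mul, hx, hx']
  | ι_mul x u hx =>
    have h : ExteriorAlgebra.ι R v * ι 0 u = -(ι 0 u * ExteriorAlgebra.ι R v) :=
      eq_neg_of_add_eq_zero_left (ExteriorAlgebra.ι_add_mul_swap v u)
    rw [← mul_assoc, h, neg_mul, mul_assoc, hx, map_mul, involute_ι, neg_mul, neg_mul, mul_assoc]

theorem mul_eq_mul_involute_pow {a : ℕ} {x : ExteriorAlgebra R M}
    (hx : involute x = (-1 : R) ^ a • x) (y : ExteriorAlgebra R M) :
    y * x = x * (involute ^ a) y := by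
  induction y using CliffordAlgebra.left_induction with
  | algebraMap r => rw [AlgHom.commutes]; exact Algebra.commutes r x
  | add y y' hy hy' => rw [map_add, add_mul, mul_add, hy, hy']
  | ι_mul y v hy =>
    have hv : (involute ^ a) (ι (0 : QuadraticForm R M) v) = (-1 : R) ^ a • ι 0 v :=
      algHom_pow_apply_eq_pow_smul (by rw [involute_ι, neg_one_smul]) a
    have hvx : ι 0 v * x = x * ((-1 : R) ^ a • ι 0 v) := by
      rw [mul_smul_comm, ← smul_mul_assoc, ← hx]
      exact ι_mul_eq_involute_mul v x
    rw [mul_assoc, hy, ← mul_assoc, hvx, map_mul, hv, mul_assoc]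

theorem exteriorAlgebra_supercomm {a b : ℕ} {x y : ExteriorAlgebra R M}
    (hx : involute x = (-1 : R) ^ a • x) (hy : involute y = (-1 : R) ^ b • y) :
    x * y = (-1 : R) ^ (a * b) • (y * x) := by
  rw [mul_eq_mul_involute_pow hy x, algHom_pow_apply_eq_pow_smul hx, mul_smul_comm, pow_mul]

end Exterior

section PartialDerivatives

variable {n m k : ℕ}

/-- The norm of the coordinate vector in a basis. It serves to apply the calculus of functions
between normed spaces to superfunctions; any other norm would do. -/
instance grassmannNormedAddCommGroup : NormedAddCommGroup (Grassmann n m k) :=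
  NormedAddCommGroup.induced (Grassmann n m k) _
    (Module.finBasis ℝ (Grassmann n m k)).equivFun
    (Module.finBasis ℝ (Grassmann n m k)).equivFun.injective

instance grassmannNormedSpace : NormedSpace ℝ (Grassmann n m k) :=
  NormedSpace.induced ℝ (Grassmann n m k) _ (Module.finBasis ℝ (Grassmann n m k)).equivFun

variable {W : Set (Body n m k)} {f g : SuperFun n m k} {z w : Coordinate n m k} {p : Body n m k}

theorem smoothOn_iff_contDiffOn : SmoothOn W f ↔ ContDiffOn ℝ ∞ f W := by
  refine ⟨fun h => ?_, fun h l => (LinearMap.toContinuousLinearMap l).contDiff.comp_contDiffOn h⟩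
  rw [show f = fun p => ∑ j, (Module.finBasis ℝ (Grassmann n m k)).repr (f p) j •
    Module.finBasis ℝ (Grassmann n m k) j from funext fun p => (Module.Basis.sum_repr _ (f p)).symm]
  exact ContDiffOn.sum fun j _ => ((smoothOn_iff W f).1 h j).smul contDiffOn_const

theorem SmoothOn.contDiffAt (hf : SmoothOn W f) (hW : IsOpen W) (hp : p ∈ W) :
    ContDiffAt ℝ ∞ f p :=
  (smoothOn_iff_contDiffOn.1 hf).contDiffAt (hW.mem_nhds hp)

theorem SmoothOn.differentiableAt (hf : SmoothOn W f) (hW : IsOpen W) (hp : p ∈ W) :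
    DifferentiableAt ℝ f p :=
  (hf.contDiffAt hW hp).differentiableAt (by simp)

theorem SmoothOn.linearMap_comp (hf : SmoothOn W f)
    (T : Grassmann n m k →ₗ[ℝ] Grassmann n m k) : SmoothOn W fun p => T (f p) :=
  fun l => hf (l ∘ₗ T)

theorem SmoothOn.congr (hf : SmoothOn W f) (h : Set.EqOn g f W) : SmoothOn W g :=
  fun l => (hf l).congr fun p hp => by rw [h hp]

theorem SmoothOn.twist (hf : SmoothOn W f) (r : ℕ) : SmoothOn W (twist r f) := by
  rw [show WeakKoszul.twist r f = fun p => (CliffordAlgebra.involute ^ r).toLinearMap (f p) from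
    funext fun p => by rw [AlgHom.toLinearMap_apply, AlgHom.coe_pow, WeakKoszul.twist]]
  exact hf.linearMap_comp _

theorem twist_congr {r t : ℕ} (h : Even r ↔ Even t) (f : SuperFun n m k) :
    twist r f = twist t f := by
  have hi := CliffordAlgebra.involute_involutive
    (Q := (0 : QuadraticForm ℝ (OddCoord n m k → ℝ)))
  unfold twist
  rcases Nat.even_or_odd r with hr | hr
  · rw [hi.iterate_even hr, hi.iterate_even (h.1 hr)]
  · have ht : Odd t := by rwa [← Nat.not_even_iff_odd, ← h, Nat.not_even_iff_odd]
    rw [hi.iterate_odd hr, hi.iterate_odd ht]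

theorem pd_of_even (hz : Even z.parity) (hf : DifferentiableAt ℝ f p) :
    pd z f p = fderiv ℝ f p (Pi.single (⟨z, hz⟩ : EvenCoord n m k) 1) := by
  have component (j) := ((LinearMap.toContinuousLinearMap
    ((Module.finBasis ℝ (Grassmann n m k)).coord j)).hasFDerivAt.comp p hf.hasFDerivAt).fderiv
  rw [pd, dif_pos hz]
  conv_rhs => rw [← (Module.finBasis ℝ (Grassmann n m k)).sum_repr (fderiv ℝ f p _)]
  exact Finset.sum_congr rfl fun j _ => congrArg (· • _) (DFunLike.congr_fun (component j) _)

theorem pd_of_odd (hz : ¬ Even z.parity) (f : SuperFun n m k) (p : Body n m k) :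
    pd z f p = CliffordAlgebra.contractLeft
      (LinearMap.proj (⟨z, hz⟩ : OddCoord n m k) : (OddCoord n m k → ℝ) →ₗ[ℝ] ℝ) (f p) := by
  rw [pd, dif_neg hz]

theorem pd_congr (h : f =ᶠ[nhds p] g) (z : Coordinate n m k) : pd z f p = pd z g p := by
  by_cases hz : Even z.parity
  · have component (j) : fderiv ℝ (fun q => (Module.finBasis ℝ (Grassmann n m k)).repr (f q) j) p =
        fderiv ℝ (fun q => (Module.finBasis ℝ (Grassmann n m k)).repr (g q) j) p :=
      (h.fun_comp fun x => (Module.finBasis ℝ (Grassmann n m k)).repr x j).fderiv_eq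
    simp only [pd, dif_pos hz, component]
  · rw [pd_of_odd hz, pd_of_odd hz, h.eq_of_nhds]

theorem SmoothOn.pd (hf : SmoothOn W f) (hW : IsOpen W) (z : Coordinate n m k) :
    SmoothOn W (pd z f) := by
  by_cases hz : Even z.parity
  · have h : ContDiffOn ℝ ∞ (fun p => fderiv ℝ f p
        (Pi.single (⟨z, hz⟩ : EvenCoord n m k) (1 : ℝ))) W :=
      ((smoothOn_iff_contDiffOn.1 hf).fderiv_of_isOpen hW (by simp)).clm_apply contDiffOn_const
    exact (smoothOn_iff_contDiffOn.2 h).congr fun p hp =>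
      pd_of_even hz (hf.differentiableAt hW hp)
  · exact (hf.linearMap_comp _).congr fun p _ => pd_of_odd hz f p

theorem pd_linearMap_comp (hz : Even z.parity) (hf : DifferentiableAt ℝ f p)
    (T : Grassmann n m k →ₗ[ℝ] Grassmann n m k) : pd z (fun q => T (f q)) p = T (pd z f p) := by
  have h : HasFDerivAt (fun q => T (f q)) _ p :=
    (LinearMap.toContinuousLinearMap T).hasFDerivAt.comp p hf.hasFDerivAt
  rw [pd_of_even hz h.differentiableAt, pd_of_even hz hf, h.fderiv]
  rfl

theorem pd_add (hf : DifferentiableAt ℝ f p) (hg : DifferentiableAt ℝ g p)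
    (z : Coordinate n m k) : pd z (f + g) p = pd z f p + pd z g p := by
  by_cases hz : Even z.parity
  · rw [pd_of_even hz (hf.add hg), pd_of_even hz hf, pd_of_even hz hg, fderiv_add hf hg,
      add_apply]
  · simp only [pd_of_odd hz, Pi.add_apply, map_add]

theorem pd_smul (hf : DifferentiableAt ℝ f p) (t : ℝ) (z : Coordinate n m k) :
    pd z (t • f) p = t • pd z f p := by
  by_cases hz : Even z.parity
  · exact pd_linearMap_comp hz hf (LinearMap.lsmul ℝ (Grassmann n m k) t)
  · simp only [pd_of_odd hz, Pi.smul_apply, map_smul]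

theorem pd_mul (hf : DifferentiableAt ℝ f p) (hg : DifferentiableAt ℝ g p)
    (z : Coordinate n m k) :
    pd z (f * g) p = pd z f p * g p + twist z.parity f p * pd z g p := by
  by_cases hz : Even z.parity
  · have h : HasFDerivAt (f * g) _ p := (LinearMap.mul ℝ
      (Grassmann n m k)).toContinuousBilinearMap.hasFDerivAt_of_bilinear
        hf.hasFDerivAt hg.hasFDerivAt
    rw [pd_of_even hz h.differentiableAt, pd_of_even hz hf, pd_of_even hz hg, h.fderiv,
      twist_congr (t := 0) (by simpa using hz)]
    exact add_comm _ _
  · rw [twist_congr (t := 1) (by simpa using hz)]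
    simp only [pd_of_odd hz, Pi.mul_apply, contractLeft_mul, twist, Function.iterate_one]

theorem involute_pd (hf : DifferentiableAt ℝ f p) (z : Coordinate n m k) :
    CliffordAlgebra.involute (pd z f p) = (-1 : ℝ) ^ z.parity • pd z (twist 1 f) p := by
  by_cases hz : Even z.parity
  · rw [hz.neg_one_pow, one_smul]
    exact (pd_linearMap_comp hz hf (AlgHom.toLinearMap CliffordAlgebra.involute)).symm
  · rw [(Nat.not_even_iff_odd.1 hz).neg_one_pow, neg_one_smul, pd_of_odd hz, pd_of_odd hz,
      involute_contractLeft, twist, Function.iterate_one]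

theorem SmoothOn.pd_pd_of_even (hf : SmoothOn W f) (hW : IsOpen W) (hp : p ∈ W)
    (hz : Even z.parity) (hw : Even w.parity) :
    WeakKoszul.pd z (WeakKoszul.pd w f) p = fderiv ℝ (fderiv ℝ f) p
      (Pi.single (⟨z, hz⟩ : EvenCoord n m k) 1) (Pi.single (⟨w, hw⟩ : EvenCoord n m k) 1) := by
  have hd : DifferentiableAt ℝ (fderiv ℝ f) p :=
    ((hf.contDiffAt hW hp).fderiv_right (m := ∞) (by simp)).differentiableAt (by simp)
  have h : WeakKoszul.pd w f =ᶠ[nhds p]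
      fun q => fderiv ℝ f q (Pi.single (⟨w, hw⟩ : EvenCoord n m k) 1) := by
    filter_upwards [hW.mem_nhds hp] with q hq
    exact pd_of_even hw (hf.differentiableAt hW hq)
  rw [pd_of_even hz ((hf.pd hW w).differentiableAt hW hp), h.fderiv_eq,
    fderiv_clm_apply hd (differentiableAt_const _)]
  simp

theorem pd_pd_of_odd_of_even (hf : DifferentiableAt ℝ f p) (hz : ¬ Even z.parity)
    (hw : Even w.parity) : pd z (pd w f) p = pd w (pd z f) p := by
  rw [pd_of_odd hz, ← pd_linearMap_comp hw hf]
  exact congrArg (pd w · p) (funext fun q => (pd_of_odd hz f q).symm)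

theorem SmoothOn.pd_pd_comm (hf : SmoothOn W f) (hW : IsOpen W) (hp : p ∈ W)
    (z w : Coordinate n m k) :
    WeakKoszul.pd z (WeakKoszul.pd w f) p =
      (-1 : ℝ) ^ (z.parity * w.parity) • WeakKoszul.pd w (WeakKoszul.pd z f) p := by
  have hfp := hf.differentiableAt hW hp
  by_cases hz : Even z.parity <;> by_cases hw : Even w.parity
  · rw [(hz.mul_right _).neg_one_pow, one_smul, hf.pd_pd_of_even hW hp hz hw,
      hf.pd_pd_of_even hW hp hw hz]
    have h2 : minSmoothness ℝ 2 ≤ ∞ := by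
      simpa using (WithTop.coe_le_coe.2 le_top : ((2 : ℕ∞) : ℕ∞ω) ≤ ∞)
    exact ((hf.contDiffAt hW hp).isSymmSndFDerivAt h2).eq _ _
  · rw [(hz.mul_right _).neg_one_pow, one_smul, pd_pd_of_odd_of_even hfp hw hz]
  · rw [(hw.mul_left _).neg_one_pow, one_smul, pd_pd_of_odd_of_even hfp hz hw]
  · rw [((Nat.not_even_iff_odd.1 hz).mul (Nat.not_even_iff_odd.1 hw)).neg_one_pow, neg_one_smul]
    simp only [pd_of_odd hz, pd_of_odd hw]
    exact CliffordAlgebra.contractLeft_comm _ _ _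

theorem pd_coord (z w : Coordinate n m k) (p : Body n m k) :
    pd z (coord w) p = if z = w then 1 else 0 := by
  have hd : DifferentiableAt ℝ (coord w) p :=
    (smoothOn_coord Set.univ w).differentiableAt isOpen_univ (Set.mem_univ p)
  by_cases hw : Even w.parity
  · let L : Body n m k →ₗ[ℝ] Grassmann n m k :=
      Algebra.linearMap ℝ (Grassmann n m k) ∘ₗ LinearMap.proj ⟨w, hw⟩
    have e : coord w = L.toContinuousLinearMap := funext fun q => by rw [coord, dif_pos hw]; rfl
    by_cases hz : Even z.parity
    · rw [pd_of_even hz hd, e, ContinuousLinearMap.fderiv]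
      simp [L, Pi.single_apply, apply_ite, eq_comm]
    · have hzw : z ≠ w := by rintro rfl; exact hz hw
      rw [pd_of_odd hz, coord, dif_pos hw, CliffordAlgebra.contractLeft_algebraMap, if_neg hzw]
  · have e : coord w = fun _ : Body n m k =>
        ExteriorAlgebra.ι ℝ (Pi.single (⟨w, hw⟩ : OddCoord n m k) (1 : ℝ)) :=
      funext fun q => by rw [coord, dif_neg hw]
    by_cases hz : Even z.parity
    · have hzw : z ≠ w := by rintro rfl; exact hw hz
      rw [pd_of_even hz hd, e, if_neg hzw, fderiv_const_apply, zero_apply]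
    · rw [pd_of_odd hz, e, ExteriorAlgebra.ι, CliffordAlgebra.contractLeft_ι, LinearMap.proj_apply]
      simp only [Pi.single_apply, Subtype.mk.injEq]
      split_ifs <;> simp

end PartialDerivatives

section Restriction

variable {n m k : ℕ}

/-- The linear map which sets to zero the components selected by `s`. -/
def eraseComponents {ι : Type*} (s : ι → Bool) : (ι → ℝ) →ₗ[ℝ] (ι → ℝ) :=
  LinearMap.pi fun i => if s i then 0 else LinearMap.proj i

theorem eraseComponents_apply {ι : Type*} (s : ι → Bool) (v : ι → ℝ) (i : ι) :
    eraseComponents s v i = if s i then 0 else v i := by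
  rw [eraseComponents, LinearMap.pi_apply]
  split_ifs <;> rfl

theorem eraseComponents_single {ι : Type*} [DecidableEq ι] (s : ι → Bool) (i : ι) :
    eraseComponents s (Pi.single i 1) = if s i then 0 else Pi.single i 1 := by
  funext j
  rw [eraseComponents_apply]
  rcases eq_or_ne j i with rfl | h
  · split_ifs <;> simp
  · split_ifs <;> simp [Pi.single_eq_of_ne h]

theorem eraseComponents_comp {ι : Type*} {s t : ι → Bool} (h : ∀ i, t i = true → s i = true) :
    eraseComponents t ∘ₗ eraseComponents s = eraseComponents s ∧
      eraseComponents s ∘ₗ eraseComponents t = eraseComponents s := by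
  constructor <;> ext v i <;> simp only [LinearMap.comp_apply, eraseComponents_apply] <;> grind

/-- The point of the body with the coordinates selected by `s` set to zero. -/
abbrev restrictPoint (s : Coordinate n m k → Bool) : Body n m k →ₗ[ℝ] Body n m k :=
  eraseComponents fun z : EvenCoord n m k => s z.1

/-- The endomorphism of the Grassmann algebra which kills the generators selected by `s`. -/
abbrev restrictGrassmann (s : Coordinate n m k → Bool) : Grassmann n m k →ₐ[ℝ] Grassmann n m k :=
  ExteriorAlgebra.map (eraseComponents fun z : OddCoord n m k => s z.1)

variable {W : Set (Body n m k)} {f : SuperFun n m k} {s t : Coordinate n m k → Bool}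
  {z : Coordinate n m k}

theorem restrict_apply (s : Coordinate n m k → Bool) (f : SuperFun n m k) (p : Body n m k) :
    restrict s f p = restrictGrassmann s (f (restrictPoint s p)) := by
  rw [restrict, show restrictPoint s p = fun z => if s z.1 then 0 else p z from
    funext (eraseComponents_apply _ p)]
  rfl

theorem SmoothOn.restrict (hf : SmoothOn W f) (hs : Set.MapsTo (restrictPoint s) W W) :
    SmoothOn W (restrict s f) := by
  have h : SmoothOn W fun p => f (restrictPoint s p) := fun l =>
    (hf l).comp (LinearMap.toContinuousLinearMap (restrictPoint s)).contDiff.contDiffOn hs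
  exact (h.linearMap_comp (restrictGrassmann s).toLinearMap).congr
    fun p _ => restrict_apply s f p

theorem pd_restrict {p : Body n m k} (hf : DifferentiableAt ℝ f (restrictPoint s p))
    (z : Coordinate n m k) :
    pd z (restrict s f) p = if s z then 0 else restrict s (pd z f) p := by
  have e : restrict s f = fun q => (restrictGrassmann s).toLinearMap (f (restrictPoint s q)) :=
    funext (restrict_apply s f)
  by_cases hz : Even z.parity
  · have h : HasFDerivAt (fun q => f (restrictPoint s q)) _ p :=
      hf.hasFDerivAt.comp p (LinearMap.toContinuousLinearMap (restrictPoint s)).hasFDerivAt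
    rw [e, pd_linearMap_comp hz h.differentiableAt, pd_of_even hz h.differentiableAt, h.fderiv,
      restrict_apply, pd_of_even hz hf, ContinuousLinearMap.comp_apply,
      LinearMap.coe_toContinuousLinearMap', eraseComponents_single]
    split_ifs <;> simp
  · have hd : (LinearMap.proj (⟨z, hz⟩ : OddCoord n m k) : (OddCoord n m k → ℝ) →ₗ[ℝ] ℝ) ∘ₗ
        eraseComponents (fun z : OddCoord n m k => s z.1) =
        if s z then 0 else LinearMap.proj (⟨z, hz⟩ : OddCoord n m k) := by
      ext v
      split_ifs with h <;> simp [eraseComponents_apply, h]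
    rw [e, pd_of_odd hz, restrict_apply, pd_of_odd hz, AlgHom.toLinearMap_apply, contractLeft_map,
      hd]
    split_ifs <;> simp

theorem restrict_restrict (h : ∀ z, t z = true → s z = true) (f : SuperFun n m k) :
    restrict s (restrict t f) = restrict s f := by
  have hp := (eraseComponents_comp fun z : EvenCoord n m k => h z).1
  have ho := (eraseComponents_comp fun z : OddCoord n m k => h z).2
  funext p
  simp only [restrict_apply]
  rw [← LinearMap.comp_apply, hp, ← AlgHom.comp_apply, ExteriorAlgebra.map_comp_map, ho]

theorem restrict_coord (hz : s z = true) : restrict s (coord z) = 0 := by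
  funext p
  rw [restrict_apply, coord]
  split_ifs with h
  · rw [eraseComponents_apply, if_pos hz, map_zero, map_zero, Pi.zero_apply]
  · rw [ExteriorAlgebra.map_apply_ι, eraseComponents_single, if_pos hz, map_zero, Pi.zero_apply]

end Restriction

section SmoothFunctions

variable {n m k : ℕ}

/-- The coordinate conjugate to `z` with respect to the Poisson bracket: `φ^A` is paired with
`dφ*_A` and `φ*_A` with `dφ^A`. -/
def Coordinate.conj (z : Coordinate n m k) : Coordinate n m k := ((!z.1.1, !z.1.2), z.2)

/-- The coefficient of `∂f/∂z ∂g/∂z'` in the Poisson bracket, where `z'` is conjugate to `z`; the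
remaining signs come from moving `∂/∂z` past `f`. -/
def Coordinate.bracketSign (z : Coordinate n m k) : ℝ :=
  if z.1.1 then (-1) ^ z.2.parity else if z.1.2 then 1 else -1

theorem Coordinate.even_parity_conj (z : Coordinate n m k) :
    Even z.conj.parity ↔ Even z.parity := by
  rcases z with ⟨⟨_ | _, _ | _⟩, A⟩ <;>
    simp [Coordinate.conj, Coordinate.parity, Nat.even_add]

theorem Coordinate.bracketSign_conj (z : Coordinate n m k) :
    z.conj.bracketSign = -((-1 : ℝ) ^ z.parity * z.bracketSign) := by
  rcases z with ⟨⟨_ | _, _ | _⟩, A⟩ <;> rcases Nat.even_or_odd A.parity with h | h <;>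
    simp [Coordinate.conj, Coordinate.bracketSign, Coordinate.parity, pow_add, h.neg_one_pow]

theorem bracket_eq_sum (f g : SuperFun n m k) :
    bracket f g = ∑ z : Coordinate n m k,
      z.bracketSign • (pd z (twist z.parity f) * pd z.conj g) := by
  rw [Fintype.sum_prod_type_right]
  refine Finset.sum_congr rfl fun A _ => ?_
  rw [Fintype.sum_prod_type, Fintype.sum_bool, Fintype.sum_bool, Fintype.sum_bool]
  have h : twist (A.parity + 1 + 1) f = twist A.parity f :=
    twist_congr (by simp [Nat.even_add]) f
  simp only [smul_add, Coordinate.bracketSign, ↓reduceIte, Coordinate.parity, h, Coordinate.conj,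
    Bool.not_true, Bool.false_eq_true, add_zero, Bool.not_false, one_smul, neg_smul]
  abel

variable {W : Set (Body n m k)}

/-- The smooth function `u` on the superdomain over `W` is given by `f`, whose values off `W` play
no role. -/
def Represents (u : smoothFunctions W) (f : SuperFun n m k) : Prop :=
  ∀ p (hp : p ∈ W), u.1 ⟨p, hp⟩ = f p

/-- A superfunction which represents `u`. -/
def extension (u : smoothFunctions W) : SuperFun n m k := u.2.choose

theorem smoothOn_extension (u : smoothFunctions W) : SmoothOn W (extension u) :=
  u.2.choose_spec.1

theorem represents_extension (u : smoothFunctions W) : Represents u (extension u) := fun p hp =>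
  (congrFun u.2.choose_spec.2 ⟨p, hp⟩).symm

theorem represents_toSmooth {f : SuperFun n m k} (hf : SmoothOn W f) :
    Represents (toSmooth W f hf) f := fun _ _ => rfl

namespace Represents

variable {u v : smoothFunctions W} {f g : SuperFun n m k}

theorem eqOn (hf : Represents u f) (hg : Represents u g) : Set.EqOn f g W := fun p hp =>
  (hf p hp).symm.trans (hg p hp)

theorem eqOn_of_eq (hf : Represents u f) (hg : Represents v g) (h : u = v) : Set.EqOn f g W :=
  hf.eqOn (h ▸ hg)

theorem congr (hf : Represents u f) (h : Set.EqOn f g W) : Represents u g := fun p hp =>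
  (hf p hp).trans (h hp)

theorem ext (hf : Represents u f) (hg : Represents v g) (h : Set.EqOn f g W) : u = v :=
  Subtype.ext (funext fun p => (hf.congr h p.1 p.2).trans (hg p.1 p.2).symm)

theorem smoothOn (hf : Represents u f) : SmoothOn W f :=
  (smoothOn_extension u).congr (hf.eqOn (represents_extension u))

theorem zero : Represents (0 : smoothFunctions W) 0 := fun _ _ => rfl

theorem add (hf : Represents u f) (hg : Represents v g) : Represents (u + v) (f + g) :=
  fun p hp => congrArg₂ (· + ·) (hf p hp) (hg p hp)

theorem sub (hf : Represents u f) (hg : Represents v g) : Represents (u - v) (f - g) :=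
  fun p hp => congrArg₂ (· - ·) (hf p hp) (hg p hp)

theorem mul (hf : Represents u f) (hg : Represents v g) : Represents (u * v) (f * g) :=
  fun p hp => congrArg₂ (· * ·) (hf p hp) (hg p hp)

theorem smul (hf : Represents u f) (t : ℝ) : Represents (t • u) (t • f) :=
  fun p hp => congrArg (t • ·) (hf p hp)

theorem sum {ι : Type*} [Fintype ι] {u : ι → smoothFunctions W} {f : ι → SuperFun n m k}
    (h : ∀ i, Represents (u i) (f i)) : Represents (∑ i, u i) (∑ i, f i) := fun p hp => by
  simp only [AddSubmonoidClass.coe_finsetSum, Finset.sum_apply, h _ p hp]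

end Represents

/-- The parity involution of the algebra of smooth functions. -/
def smoothInvol : smoothFunctions W →ₐ[ℝ] smoothFunctions W :=
  ((CliffordAlgebra.involute.compLeft W).comp (smoothFunctions W).val).codRestrict _ fun u =>
    ⟨twist 1 (extension u), (smoothOn_extension u).twist 1, funext fun p =>
      congrArg CliffordAlgebra.involute (represents_extension u p.1 p.2).symm⟩

/-- Restriction to a coordinate subspace on the algebra of smooth functions. -/
def smoothRestrict {s : Coordinate n m k → Bool} (hs : Set.MapsTo (restrictPoint s) W W) :
    smoothFunctions W →ₐ[ℝ] smoothFunctions W :=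
  (AlgHom.pi fun p : W => (restrictGrassmann s).comp
    ((Pi.evalAlgHom ℝ (fun _ : W => Grassmann n m k) (hs.restrict _ W W p)).comp
      (smoothFunctions W).val)).codRestrict _ fun u =>
    ⟨restrict s (extension u), (smoothOn_extension u).restrict hs, funext fun p =>
      (restrict_apply s _ p.1).trans (congrArg (restrictGrassmann s)
        (represents_extension u _ (hs p.2)).symm)⟩

namespace Represents

variable {u : smoothFunctions W} {f : SuperFun n m k}

theorem invol (hf : Represents u f) : Represents (smoothInvol u) (twist 1 f) := fun p hp =>
  congrArg CliffordAlgebra.involute (hf p hp)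

theorem invol_pow (hf : Represents u f) (r : ℕ) :
    Represents ((smoothInvol ^ r) u) (twist r f) := by
  induction r with
  | zero => exact hf
  | succ r ih =>
    rw [pow_succ', AlgHom.mul_apply]
    exact ih.invol.congr fun p _ => (Function.iterate_succ_apply' _ r (f p)).symm

theorem restrict {s : Coordinate n m k → Bool} (hs : Set.MapsTo (restrictPoint s) W W)
    (hf : Represents u f) : Represents (smoothRestrict hs u) (restrict s f) := fun p hp =>
  (congrArg (restrictGrassmann s) (hf _ (hs hp))).trans (restrict_apply s f p).symm

end Represents

theorem pd_eqOn (hW : IsOpen W) {f g : SuperFun n m k} (h : Set.EqOn f g W)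
    (z : Coordinate n m k) : Set.EqOn (pd z f) (pd z g) W := fun _ hp =>
  pd_congr (h.eventuallyEq_of_mem (hW.mem_nhds hp)) z

/-- The partial derivatives on the algebra of smooth functions. -/
def smoothPd (hW : IsOpen W) (z : Coordinate n m k) :
    smoothFunctions W →ₗ[ℝ] smoothFunctions W where
  toFun u := toSmooth W (pd z (extension u)) ((smoothOn_extension u).pd hW z)
  map_add' u v := by
    refine (represents_toSmooth _).ext ((represents_toSmooth _).add (represents_toSmooth _)) ?_
    refine (pd_eqOn hW ((represents_extension _).eqOn
      ((represents_extension u).add (represents_extension v))) z).trans fun p hp => ?_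
    exact pd_add ((smoothOn_extension u).differentiableAt hW hp)
      ((smoothOn_extension v).differentiableAt hW hp) z
  map_smul' t u := by
    refine (represents_toSmooth _).ext ((represents_toSmooth _).smul t) ?_
    refine (pd_eqOn hW ((represents_extension _).eqOn
      ((represents_extension u).smul t)) z).trans fun p hp => ?_
    exact pd_smul ((smoothOn_extension u).differentiableAt hW hp) t z

theorem Represents.pd {u : smoothFunctions W} {f : SuperFun n m k} (hW : IsOpen W)
    (hf : Represents u f) (z : Coordinate n m k) : Represents (smoothPd hW z u) (pd z f) :=
  (represents_toSmooth ((smoothOn_extension u).pd hW z)).congr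
    (pd_eqOn hW ((represents_extension u).eqOn hf) z)

/-- The smooth functions on the superdomain over `W`, with the Poisson structure of `Π T 𝒩`. -/
def smoothSuperalgebra (hW : IsOpen W) :
    DarbouxSuperalgebra ℝ (Coordinate n m k) (smoothFunctions W) where
  parity := Coordinate.parity
  invol := smoothInvol
  D := smoothPd hW
  D_mul z u v := by
    have hu := represents_extension u
    have hv := represents_extension v
    exact ((hu.mul hv).pd hW z).ext
      (((hu.pd hW z).mul hv).add ((hu.invol_pow z.parity).mul (hv.pd hW z))) fun p hp =>
        pd_mul (hu.smoothOn.differentiableAt hW hp) (hv.smoothOn.differentiableAt hW hp) z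
  invol_D z u := by
    have hu := represents_extension u
    exact (hu.pd hW z).invol.ext ((hu.invol.pd hW z).smul _) fun p hp =>
      involute_pd (hu.smoothOn.differentiableAt hW hp) z
  D_comm z w u := by
    have hu := represents_extension u
    exact ((hu.pd hW w).pd hW z).ext (((hu.pd hW z).pd hW w).smul _) fun p hp =>
      hu.smoothOn.pd_pd_comm hW hp z w
  supercomm a b u v hu hv := Subtype.ext <| funext fun p => exteriorAlgebra_supercomm
    (congrFun (congrArg Subtype.val hu) p) (congrFun (congrArg Subtype.val hv) p)
  conj := Coordinate.conj
  sign := Coordinate.bracketSign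
  conj_involutive z := by simp only [Coordinate.conj, Bool.not_not]
  even_parity_conj := Coordinate.even_parity_conj
  sign_conj := Coordinate.bracketSign_conj

theorem Represents.bracket {u v : smoothFunctions W} {f g : SuperFun n m k} (hW : IsOpen W)
    (hf : Represents u f) (hg : Represents v g) :
    Represents ((smoothSuperalgebra hW).pb u v) (bracket f g) := by
  rw [bracket_eq_sum, DarbouxSuperalgebra.pb_apply]
  exact .sum fun z => (((hf.invol_pow z.parity).pd hW z).mul (hg.pd hW z.conj)).smul _

theorem smoothRestrict_isLagrangian (hW : IsOpen W) {s : Coordinate n m k → Bool}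
    (hs : Set.MapsTo (restrictPoint s) W W) (hc : ∀ z : Coordinate n m k, s z.conj = !s z) :
    IsLagrangianRestriction (smoothSuperalgebra hW) s (smoothRestrict hs) where
  conj := hc
  idem u := by
    have hu := (represents_extension u).restrict hs
    exact (hu.restrict hs).ext hu (by rw [restrict_restrict fun _ h => h]; exact Set.eqOn_refl _ _)
  commute_invol := AlgHom.ext fun u => by
    have hu := represents_extension u
    refine (hu.invol.restrict hs).ext (hu.restrict hs).invol fun p _ => ?_
    rw [restrict_apply, twist, twist, restrict_apply]
    exact map_involute _ _
  D_tangent z hz u := by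
    have hu := represents_extension u
    refine ((hu.restrict hs).pd hW z).ext ((hu.pd hW z).restrict hs) fun p hp => ?_
    rw [pd_restrict (hu.smoothOn.differentiableAt hW (hs hp)), hz, if_neg Bool.false_ne_true]
  D_normal z hz u := by
    have hu := represents_extension u
    refine ((hu.restrict hs).pd hW z).ext .zero fun p hp => ?_
    rw [pd_restrict (hu.smoothOn.differentiableAt hW (hs hp)), if_pos hz, Pi.zero_apply]

end SmoothFunctions

section CanonicalDelta

variable {n m k : ℕ} {W : Set (Body n m k)}

/-- A coordinate in the algebra of smooth functions. -/
def smoothCoord (W : Set (Body n m k)) (z : Coordinate n m k) : smoothFunctions W :=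
  toSmooth W (coord z) (smoothOn_coord W z)

theorem smoothPd_coord_mem_bot (hW : IsOpen W) (z w : Coordinate n m k) :
    smoothPd hW z (smoothCoord W w) ∈ (⊥ : Subalgebra ℝ (smoothFunctions W)) := by
  have h : smoothPd hW z (smoothCoord W w) = if z = w then 1 else 0 :=
    Subtype.ext <| funext fun p => by
      refine ((represents_toSmooth (smoothOn_coord W w)).pd hW z p.1 p.2).trans ?_
      rw [pd_coord]
      split_ifs <;> rfl
  rw [h]
  split_ifs
  exacts [one_mem _, zero_mem _]

theorem smoothRestrict_coord {s : Coordinate n m k → Bool}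
    (hs : Set.MapsTo (restrictPoint s) W W) {z : Coordinate n m k} (hz : s z = true) :
    smoothRestrict hs (smoothCoord W z) = 0 :=
  ((represents_toSmooth _).restrict hs).ext .zero (by rw [restrict_coord hz]; exact fun _ _ => rfl)

theorem smoothCoord_mem_homogeneous (hW : IsOpen W) (z : Coordinate n m k) :
    smoothCoord W z ∈ (smoothSuperalgebra hW).homogeneous z.parity := by
  have h := represents_toSmooth (smoothOn_coord W z)
  refine DarbouxSuperalgebra.mem_homogeneous.2 (h.invol.ext (h.smul _) fun p _ => ?_)
  rw [twist, Function.iterate_one, Pi.smul_apply, coord]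
  split_ifs with hz
  · rw [hz.neg_one_pow, one_smul, AlgHom.commutes]
  · rw [(Nat.not_even_iff_odd.1 hz).neg_one_pow, neg_one_smul]
    exact CliffordAlgebra.involute_ι _

/-- The canonical odd function `Δ` in the algebra of smooth functions. -/
def smoothDelta (W : Set (Body n m k)) : smoothFunctions W :=
  ∑ A : Idx n m k, (-1 : ℝ) ^ A.parity • (smoothCoord W (dfld A) * smoothCoord W (dmom A))

theorem represents_smoothDelta : Represents (smoothDelta W) canonicalDelta :=
  .sum fun _ => ((represents_toSmooth _).mul (represents_toSmooth _)).smul _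

theorem smoothDelta_mem_homogeneous (hW : IsOpen W) :
    smoothDelta W ∈ (smoothSuperalgebra hW).homogeneous 1 := by
  refine sum_mem fun A _ => Submodule.smul_mem _ _ ?_
  have h := DarbouxSuperalgebra.mul_mem_homogeneous (smoothCoord_mem_homogeneous hW (dfld A))
    (smoothCoord_mem_homogeneous hW (dmom A))
  rwa [DarbouxSuperalgebra.homogeneous_congr (b := 1)
    (by by_cases h : Even A.parity <;> simp [Coordinate.parity, Nat.even_add, h])] at h

theorem smoothPd_smoothPd_smoothDelta_mem_bot (hW : IsOpen W) (z w : Coordinate n m k) :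
    smoothPd hW z (smoothPd hW w (smoothDelta W)) ∈
      (⊥ : Subalgebra ℝ (smoothFunctions W)) := by
  simp only [smoothDelta, map_sum, map_smul]
  exact sum_mem fun A _ => Subalgebra.smul_mem _ (DarbouxSuperalgebra.D_D_mul_mem_bot
    (smoothCoord_mem_homogeneous hW (dfld A)) (smoothPd_coord_mem_bot hW · _)
    (smoothPd_coord_mem_bot hW · _) z w) _

theorem smoothRestrict_smoothDelta {s : Coordinate n m k → Bool}
    (hs : Set.MapsTo (restrictPoint s) W W) (h : ∀ A, s (dmom A) = true) :
    smoothRestrict hs (smoothDelta W) = 0 := by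
  simp only [smoothDelta, map_sum, map_smul, map_mul, smoothRestrict_coord hs (h _), mul_zero,
    smul_zero, Finset.sum_const_zero]

end CanonicalDelta

section SmoothPhaseSpace

variable {n m k : ℕ} {W : Set (Body n m k)}

/-- The smooth functions on the part of `Π T 𝒩` over `W`. -/
def smoothPhaseSpace (hW : IsOpen W) (hL : Set.MapsTo (restrictPoint fun z => z.1.2) W W)
    (hN : Set.MapsTo (restrictPoint fun z => z.1.1) W W) :
    PhaseSpace ℝ (Coordinate n m k) (smoothFunctions W) where
  toDarbouxSuperalgebra := smoothSuperalgebra hW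
  isNormalL z := z.1.2
  resL := smoothRestrict hL
  isLagrangianL := smoothRestrict_isLagrangian hW hL fun _ => rfl
  isNormalN z := z.1.1
  resN := smoothRestrict hN
  isLagrangianN := smoothRestrict_isLagrangian hW hN fun _ => rfl
  delta := smoothDelta W
  delta_mem := smoothDelta_mem_homogeneous hW
  resL_delta := smoothRestrict_smoothDelta hL fun _ => rfl
  D_D_delta := smoothPd_smoothPd_smoothDelta_mem_bot hW

variable {hW : IsOpen W} {hL : Set.MapsTo (restrictPoint fun z => z.1.2) W W}
  {hN : Set.MapsTo (restrictPoint fun z => z.1.1) W W}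

namespace Represents

variable {u v : smoothFunctions W} {V X f w : SuperFun n m k}

theorem oddBracket (hu : Represents u V) (hv : Represents v X) :
    Represents ((smoothPhaseSpace hW hL hN).oddBracket u v) (oddBracket V X) :=
  ((represents_smoothDelta.bracket hW hu).bracket hW hv).restrict hN

theorem interior (hu : Represents u X) (hv : Represents v w) :
    Represents ((smoothPhaseSpace hW hL hN).interior u v) (interior X w) :=
  (hu.invol.bracket hW hv).restrict hL

theorem extDiff (hv : Represents v w) :
    Represents ((smoothPhaseSpace hW hL hN).extDiff v) (extDiff w) :=
  (represents_smoothDelta.bracket hW hv).restrict hL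

theorem timeDeriv (hu : Represents u V) (hv : Represents v w) :
    Represents ((smoothPhaseSpace hW hL hN).timeDeriv u v) (timeDeriv V w) :=
  ((represents_smoothDelta.bracket hW hu).bracket hW hv).restrict hL

theorem lieDeriv (hu : Represents u V) (hv : Represents v w) :
    Represents ((smoothPhaseSpace hW hL hN).lieDeriv u v) (lieDeriv V w) :=
  ((hu.interior hv).extDiff).sub
    (hu.invol.interior hv.extDiff)

theorem resL_pb (hu : Represents u f) (hv : Represents v w) :
    Represents ((smoothPhaseSpace hW hL hN).resL ((smoothPhaseSpace hW hL hN).pb u v))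
      (restrictL (WeakKoszul.bracket f w)) :=
  (hu.bracket hW hv).restrict hL

end Represents

end SmoothPhaseSpace

section Global

variable {n m k : ℕ} {M : Type*} [TopologicalSpace M]
  [ChartedSpace (EuclideanSpace ℝ (Fin n)) M]
  {E : M → Type*} [∀ x, TopologicalSpace (E x)] [TopologicalSpace (TotalSpace (Fin m → ℝ) E)]
  [FiberBundle (Fin m → ℝ) E]
  {F : M → Type*} [∀ x, TopologicalSpace (F x)] [TopologicalSpace (TotalSpace (Fin k → ℝ) F)]
  [FiberBundle (Fin k → ℝ) F]

theorem continuous_xPart : Continuous (xPart (n := n) (m := m) (k := k)) :=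
  (PiLp.continuous_toLp 2 _).comp (continuous_pi fun _ => continuous_apply _)

theorem xPart_restrictPoint {s : Coordinate n m k → Bool} (hs : ∀ A, s (fld A) = false)
    (p : Body n m k) : xPart (restrictPoint s p) = xPart p := by
  simp only [xPart, eraseComponents_apply, hs, Bool.false_eq_true, if_false]

theorem CoordSystem.isOpen_domain (c : CoordSystem (n := n) (m := m) (k := k) E F) :
    IsOpen c.domain :=
  (c.chart.symm.isOpen_inter_preimage (c.chart.open_source.inter
    (c.trivE.open_baseSet.inter c.trivF.open_baseSet))).preimage continuous_xPart

theorem CoordSystem.mapsTo_domain (c : CoordSystem (n := n) (m := m) (k := k) E F)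
    {s : Coordinate n m k → Bool} (hs : ∀ A, s (fld A) = false) :
    Set.MapsTo (restrictPoint s) c.domain c.domain := fun p hp => by
  simpa only [domain, point, Set.mem_ofPred_eq, xPart_restrictPoint hs] using hp

/-- The smooth functions on the part of `Π T 𝒩` over the domain of `c`. -/
def CoordSystem.phaseSpace (c : CoordSystem (n := n) (m := m) (k := k) E F) :
    PhaseSpace ℝ (Coordinate n m k) (smoothFunctions c.domain) :=
  smoothPhaseSpace c.isOpen_domain (c.mapsTo_domain fun _ => rfl) (c.mapsTo_domain fun _ => rfl)

variable {f V : LocalFamily (n := n) (m := m) (k := k) E F}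

theorem HasDegOne.hasPositiveDeg (h : HasDegOne f) : HasPositiveDeg f := fun c p hp => by
  have hfp := h c (c.mapsTo_domain (s := fun z => !z.1.1 && z.1.2) (fun _ => rfl) hp)
  rw [restrictM, restrict_apply, ← hfp, Finset.sum_apply, map_sum]
  refine Finset.sum_eq_zero fun A _ => ?_
  rw [Pi.mul_apply, map_mul, ← restrict_apply, restrict_coord (z := mom A) rfl, Pi.zero_apply,
    zero_mul]

theorem HasPositiveDeg.restrictL_eqOn (h : HasPositiveDeg f)
    (c : CoordSystem (n := n) (m := m) (k := k) E F) :
    Set.EqOn (restrictL (f c)) 0 c.domain := fun p hp => by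
  have hfp : restrict (fun z => !z.1.1 && z.1.2) (f c) (restrictPoint _ p) = 0 :=
    h c (c.mapsTo_domain (s := fun z => z.1.2) (fun _ => rfl) hp)
  rw [restrictL, ← restrict_restrict (t := fun z => !z.1.1 && z.1.2)
    (fun z hz => (Bool.and_eq_true_iff.1 hz).2), restrict_apply, hfp, map_zero, Pi.zero_apply]

theorem isMultivector_toSmooth {a : ℕ} (hV : ∀ c, SmoothOn c.domain (V c))
    (hVN : ∀ c, Set.EqOn (restrictN (V c)) (V c) c.domain) (hVdeg : HasPositiveDeg V)
    (hVparity : HasParity a V) (c : CoordSystem (n := n) (m := m) (k := k) E F) :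
    c.phaseSpace.IsMultivector a (toSmooth c.domain (V c) (hV c)) where
  mem := DarbouxSuperalgebra.mem_homogeneous.2 <|
    (represents_toSmooth _).invol.ext ((represents_toSmooth _).smul _) (hVparity c)
  resL_eq := ((represents_toSmooth _).restrict _).ext .zero (hVdeg.restrictL_eqOn c)
  resN_eq := ((represents_toSmooth _).restrict _).ext (represents_toSmooth _) (hVN c)

end Global

end WeakKoszul

end

open scoped Manifold ContDiff in
open WeakKoszul in
theorem proposition3_general {n m k : ℕ} {M : Type*} [TopologicalSpace M]
    [ChartedSpace (EuclideanSpace ℝ (Fin n)) M]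
    {E : M → Type*} [∀ x, TopologicalSpace (E x)]
    [TopologicalSpace (Bundle.TotalSpace (Fin m → ℝ) E)] [FiberBundle (Fin m → ℝ) E]
    {F : M → Type*} [∀ x, TopologicalSpace (F x)]
    [TopologicalSpace (Bundle.TotalSpace (Fin k → ℝ) F)] [FiberBundle (Fin k → ℝ) F]
    {V X w : LocalFamily (n := n) (m := m) (k := k) E F} {εV εX : ℕ}
    (hV : IsFunctionOnN V) (hVdeg : HasPositiveDeg V) (hVparity : HasParity εV V)
    (hX : IsFunctionOnN X) (hXdeg : HasPositiveDeg X) (hXparity : HasParity εX X)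
    (hw : IsGlobal w) :
    ∀ c, Set.EqOn
        (timeDeriv (V c) (interior (X c) (w c)))
        ((-1 : ℝ) ^ ((εV + 1) * εX) • interior (X c) (timeDeriv (V c) (w c))
          + (-1 : ℝ) ^ εX • restrictL (bracket (oddBracket (V c) (X c)) (w c)))
        c.domain ∧
      Set.EqOn
        (lieDeriv (V c) (interior (X c) (w c)))
        ((-1 : ℝ) ^ ((εV + 1) * εX) • interior (X c) (lieDeriv (V c) (w c))
          + (-1 : ℝ) ^ (εX + εV) • restrictL (bracket (oddBracket (V c) (X c)) (w c)))
        c.domain := by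
  intro c
  have hVc := isMultivector_toSmooth hV.1.smooth hV.2 hVdeg hVparity c
  have hXc := isMultivector_toSmooth hX.1.smooth hX.2 hXdeg hXparity c
  have rV := represents_toSmooth (hV.1.smooth c)
  have rX := represents_toSmooth (hX.1.smooth c)
  have rω := represents_toSmooth (hw.smooth c)
  have rVXw : Represents (c.phaseSpace.resL (c.phaseSpace.pb (c.phaseSpace.oddBracket _ _) _))
      (restrictL (bracket (oddBracket (V c) (X c)) (w c))) := (rV.oddBracket rX).resL_pb rω
  exact ⟨(rV.timeDeriv (rX.interior rω)).eqOn_of_eq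
      (((rX.interior (rV.timeDeriv rω)).smul _).add (rVXw.smul _))
      (PhaseSpace.timeDeriv_interior hVc hXc _),
    (rV.lieDeriv (rX.interior rω)).eqOn_of_eq
      (((rX.interior (rV.lieDeriv rω)).smul _).add (rVXw.smul _))
      (PhaseSpace.lieDeriv_interior hVc hXc _)⟩

open scoped Manifold ContDiff in
open WeakKoszul in
theorem proposition3 {n m k : ℕ} {M : Type*} [TopologicalSpace M]
    [ChartedSpace (EuclideanSpace ℝ (Fin n)) M] [IsManifold (𝓡 n) ∞ M]
    {E : M → Type*} [∀ x, AddCommGroup (E x)] [∀ x, Module ℝ (E x)]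
    [∀ x, TopologicalSpace (E x)] [TopologicalSpace (Bundle.TotalSpace (Fin m → ℝ) E)]
    [FiberBundle (Fin m → ℝ) E] [VectorBundle ℝ (Fin m → ℝ) E]
    [ContMDiffVectorBundle ∞ (Fin m → ℝ) E (𝓡 n)]
    {F : M → Type*} [∀ x, AddCommGroup (F x)] [∀ x, Module ℝ (F x)]
    [∀ x, TopologicalSpace (F x)] [TopologicalSpace (Bundle.TotalSpace (Fin k → ℝ) F)]
    [FiberBundle (Fin k → ℝ) F] [VectorBundle ℝ (Fin k → ℝ) F]
    [ContMDiffVectorBundle ∞ (Fin k → ℝ) F (𝓡 n)]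
    (S V X w : LocalFamily (n := n) (m := m) (k := k) E F)
    (hS : IsMasterFunction S)
    (hV : IsProjectibleVectorField S V ∨ IsWeakPoissonVectorField S V)
    (hVparity : HasParity 1 V) (hVghost : HasGhost 1 V)
    (hX : IsProjectibleVectorField S X) (εX : ℕ) (hXparity : HasParity εX X)
    (hw : IsProjectibleForm S w) :
    ∀ c, Set.EqOn
        (timeDeriv (V c) (interior (X c) (w c)))
        (interior (X c) (timeDeriv (V c) (w c))
          + (-1 : ℝ) ^ εX • restrictL (bracket (oddBracket (V c) (X c)) (w c)))
        c.domain ∧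
      Set.EqOn
        (lieDeriv (V c) (interior (X c) (w c)))
        (interior (X c) (lieDeriv (V c) (w c))
          + (-1 : ℝ) ^ (εX + 1) • restrictL (bracket (oddBracket (V c) (X c)) (w c)))
        c.domain := by
  have hVN : IsFunctionOnN V := hV.elim (·.onN) (·.onN)
  have hVdeg : HasPositiveDeg V := hV.elim (·.deg.hasPositiveDeg) (·.deg)
  simpa only [one_add_one_eq_two, pow_mul, neg_one_sq, one_pow, one_smul] using
    proposition3_general hVN hVdeg hVparity hX.onN hX.deg.hasPositiveDeg hXparity hw.onL.1
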